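/- Let $d\ge 1$ be an integer and let $\mathcal M$ be a small $d$-abelian category, i.e. a small additive idempotent complete category in which every morphism has a $d$-kernel and a $d$-cokernel, every monomorphism together with any of its $d$-cokernels forms a $d$-exact sequence, and every epimorphism together with any of its $d$-kernels forms a $d$-exact sequence. Let $\operatorname{Mod}\mathcal M$ be the abelian category of additive contravariant functors from $\mathcal M$ to abelian groups, and let $\operatorname{mod}\mathcal M\subseteq\operatorname{Mod}\mathcal M$ be the full subcategory of finitely presented functors, i.e. of those $F$ that admit an exact sequence $\operatorname{Hom}_{\mathcal M}(-,X)\to\operatorname{Hom}_{\mathcal M}(-,Y)\to F\to 0$ with $X,Y\in\mathcal M$. Let $\operatorname{Eff}(\mathcal M)\subseteq\operatorname{Mod}\mathcal M$ be the full subcategory of weakly effaceable functors (those $F$ such that for all $X\in\mathcal M$ and $x\in F(X)$ there is an epimorphism $f:Y\to X$ in $\mathcal M$ with $F(f)(x)=0$), and let $\operatorname{eff}(\mathcal M)\subseteq\operatorname{mod}\mathcal M$ be the full subcategory of effaceable functors (those $F$ that admit an exact sequence $\operatorname{Hom}_{\mathcal M}(-,Y)\xrightarrow{\operatorname{Hom}(-,f)}\operatorname{Hom}_{\mathcal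 M}(-,X)\to F\to 0$ with $f:Y\to X$ an epimorphism in $\mathcal M$). Quotients are Serre quotients, i.e. localizations at the morphisms whose kernel and cokernel lie in the given subcategory. Then: 1. $\dfrac{\operatorname{Mod}\mathcal M}{\operatorname{Eff}(\mathcal M)}$ is locally coherent: it is an abelian category with filtered colimits, its finitely presented objects (those $X$ for which $\operatorname{Hom}(X,-)$ preserves filtered colimits) form a skeletally small subcategory, every object is a filtered colimit of finitely presented objects, and every finitely generated subobject of a finitely presented object is finitely presented. Here $X$ is finitely generated if $\varinjlim\operatorname{Hom}(X,Y_i)\to\operatorname{Hom}(X,\varinjlim Y_i)$ is injective for every filtered colimit $\varinjlim Y_i$. 2. $\operatorname{fp}\!\left(\dfrac{\operatorname{Mod}\mathcal M}{\operatorname{Eff}(\mathcal M)}\right)=\dfrac{\operatorname{mod}\mathcal M}{\operatorname{eff}(\mathcal M)}$: the inclusion $\operatorname{mod}\mathcal M\subseteq\operatorname{Mod}\mathcal M$ induces a functor $\dfrac{\operatorname{mod}\mathcal M}{\operatorname{eff}(\mathcal M)}\to\dfrac{\operatorname{Mod}\mathcal M}{\operatorname{Eff}(\mathcal M)}$ which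 is fully faithful and whose essential image consists exactly of the finitely presented objects. -/

import Mathlib

open CategoryTheory CategoryTheory.Limits Opposite

universe w v u

namespace DAbelian

section HigherHomologicalAlgebra

variable {C : Type u} [Category.{v} C] [Preadditive C]

/-- `g : B ⟶ D` is a weak cokernel of `f : A ⟶ B`: for every object `Y` the sequence
`Hom(D, Y) → Hom(B, Y) → Hom(A, Y)` is exact. -/
def IsWeakCokernel {A B D : C} (f : A ⟶ B) (g : B ⟶ D) : Prop :=
  ∀ ⦃Y : C⦄ (h : B ⟶ Y), f ≫ h = 0 ↔ ∃ t : D ⟶ Y, g ≫ t = h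

/-- `f : A ⟶ B` is a weak kernel of `g : B ⟶ D`: for every object `Y` the sequence
`Hom(Y, A) → Hom(Y, B) → Hom(Y, D)` is exact. -/
def IsWeakKernel {A B D : C} (f : A ⟶ B) (g : B ⟶ D) : Prop :=
  ∀ ⦃Y : C⦄ (h : Y ⟶ B), h ≫ g = 0 ↔ ∃ t : Y ⟶ A, t ≫ f = h

/-- A sequence `X⁰ ⟶ X¹ ⟶ ⋯ ⟶ Xᵈ⁺¹` with morphisms `α⁰, …, αᵈ` is right `d`-exact, that is,
`(α¹, …, αᵈ)` is a `d`-cokernel of `α⁰`: for every object `Y` the sequence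
`0 → Hom(Xᵈ⁺¹, Y) → Hom(Xᵈ, Y) → ⋯ → Hom(X¹, Y) → Hom(X⁰, Y)` is exact. -/
structure IsRightDExact (d : ℕ) (S : ComposableArrows C (d + 1)) : Prop where
  isWeakCokernel : ∀ (k : ℕ) (hk : k < d),
    IsWeakCokernel (S.map' k (k + 1)) (S.map' (k + 1) (k + 2))
  epi : Epi (S.map' d (d + 1))

/-- A sequence `X⁰ ⟶ X¹ ⟶ ⋯ ⟶ Xᵈ⁺¹` with morphisms `α⁰, …, αᵈ` is left `d`-exact, that is,
`(α⁰, …, αᵈ⁻¹)` is a `d`-kernel of `αᵈ`: for every object `Y` the sequence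
`0 → Hom(Y, X⁰) → Hom(Y, X¹) → ⋯ → Hom(Y, Xᵈ) → Hom(Y, Xᵈ⁺¹)` is exact. -/
structure IsLeftDExact (d : ℕ) (S : ComposableArrows C (d + 1)) : Prop where
  isWeakKernel : ∀ (k : ℕ) (hk : k < d),
    IsWeakKernel (S.map' k (k + 1)) (S.map' (k + 1) (k + 2))
  mono : Mono (S.map' 0 1)

/-- A `d`-abelian category. A `d`-cokernel of `f` is given by a right `d`-exact
sequence whose first morphism is (identified with) `f`, and dually for `d`-kernels. -/
structure IsDAbelian (d : ℕ) (C : Type u) [Category.{v} C] [Preadditive C] : Prop where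
  /-- with preadditivity: the category is additive -/
  hasFiniteBiproducts : HasFiniteBiproducts C
  /-- (A0) -/
  isIdempotentComplete : IsIdempotentComplete C
  /-- (A1), `d`-kernels -/
  exists_dKernel : ∀ {A B : C} (f : A ⟶ B), ∃ S : ComposableArrows C (d + 1),
    IsLeftDExact d S ∧ Nonempty (Arrow.mk (S.map' d (d + 1)) ≅ Arrow.mk f)
  /-- (A1), `d`-cokernels -/
  exists_dCokernel : ∀ {A B : C} (f : A ⟶ B), ∃ S : ComposableArrows C (d + 1),
    IsRightDExact d S ∧ Nonempty (Arrow.mk (S.map' 0 1) ≅ Arrow.mk f)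
  /-- (A2) -/
  isLeftDExact_of_mono : ∀ S : ComposableArrows C (d + 1),
    Mono (S.map' 0 1) → IsRightDExact d S → IsLeftDExact d S
  /-- (A2op) -/
  isRightDExact_of_epi : ∀ S : ComposableArrows C (d + 1),
    Epi (S.map' d (d + 1)) → IsLeftDExact d S → IsRightDExact d S

end HigherHomologicalAlgebra

section Quotients

variable {C : Type u} [Category.{v} C]

/-- The morphisms that have a kernel and a cokernel in the class of objects `P`. -/
def isoModulo [HasZeroMorphisms C] (P : ObjectProperty C) : MorphismProperty C :=
  fun _ _ f ↦ (∃ k : KernelFork f, Nonempty (IsLimit k) ∧ P k.pt) ∧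
    ∃ c : CokernelCofork f, Nonempty (IsColimit c) ∧ P c.pt

/-- For a Serre class in an abelian category, `isoModulo` is Mathlib's class of isomorphisms
modulo the Serre class. -/
lemma isoModulo_eq_isoModSerre [Abelian C] (P : ObjectProperty C) [P.IsSerreClass] :
    isoModulo P = P.isoModSerre := by
  ext X Y f
  constructor
  · rintro ⟨⟨k, ⟨hk⟩, hPk⟩, ⟨c, ⟨hc⟩, hPc⟩⟩
    exact ⟨P.prop_of_iso (hk.conePointUniqueUpToIso (limit.isLimit _)) hPk,
      P.prop_of_iso (hc.coconePointUniqueUpToIso (colimit.isColimit _)) hPc⟩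
  · rintro ⟨hk, hc⟩
    exact ⟨⟨_, ⟨limit.isLimit _⟩, hk⟩, ⟨_, ⟨colimit.isColimit _⟩, hc⟩⟩

/-- The quotient category `C / P` of an abelian category `C` by a Serre subcategory `P`:
the localization of `C` which inverts the morphisms with kernel and cokernel in `P`. -/
abbrev SerreQuotient [HasZeroMorphisms C] (P : ObjectProperty C) : Type u :=
  (isoModulo P).Localization

/-- The quotient functor `C ⥤ C / P`. -/
abbrev quotFunctor [HasZeroMorphisms C] (P : ObjectProperty C) : C ⥤ SerreQuotient P :=
  (isoModulo P).Q

end Quotients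

section LocallyCoherent

variable {C : Type u} [Category.{v} C]

/-- `X` is finitely generated: for every filtered colimit `colim Dⱼ` the natural map
`colim Hom(X, Dⱼ) → Hom(X, colim Dⱼ)` is injective. -/
def IsFinitelyGenerated (X : C) : Prop :=
  ∀ (J : Type w) [SmallCategory J] [IsFiltered J] (D : J ⥤ C) (c : Cocone D),
    IsColimit c → ∀ (i j : J) (f : X ⟶ D.obj i) (g : X ⟶ D.obj j),
      f ≫ c.ι.app i = g ≫ c.ι.app j →
        ∃ (k : J) (a : i ⟶ k) (b : j ⟶ k), f ≫ D.map a = g ≫ D.map b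

/-- A locally finitely presented category (relative to the universe `w` of small sets):
filtered colimits exist, the finitely presented objects form a skeletally small
subcategory, and every object is a filtered colimit of finitely presented objects. -/
structure IsLocallyFinitelyPresented (C : Type u) [Category.{v} C] : Prop where
  locallySmall : LocallySmall.{w} C
  hasFilteredColimits : HasFilteredColimitsOfSize.{w, w} C
  essentiallySmall :
    ObjectProperty.EssentiallySmall.{w} (ObjectProperty.isFinitelyPresentable.{w} C)
  exists_presentation : ∀ X : C,
    ObjectProperty.ind.{w} (ObjectProperty.isFinitelyPresentable.{w} C) X

/-- A locally coherent category: a locally finitely presented abelian category in which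
finitely generated subobjects of finitely presented objects are finitely presented. -/
structure IsLocallyCoherent (C : Type u) [Category.{v} C] : Prop where
  abelian : Nonempty (Abelian C)
  isLocallyFinitelyPresented : IsLocallyFinitelyPresented.{w} C
  coherent : ∀ {X Y : C} (i : X ⟶ Y), Mono i → IsFinitelyPresentable.{w} Y →
    IsFinitelyGenerated.{w} X → IsFinitelyPresentable.{w} X

end LocallyCoherent

section FunctorCategories

variable (M : Type u) [SmallCategory M] [Preadditive M]

/-- `Mod M`: the additive contravariant functors from `M` to abelian groups. -/
abbrev ModCat : Type (u + 1) := Mᵒᵖ ⥤+ AddCommGrpCat.{u}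

/-- The Yoneda functor `X ↦ Hom(-, X)` from `M` to `Mod M`. -/
abbrev yonedaMod : M ⥤ ModCat M :=
  (additiveFunctor Mᵒᵖ AddCommGrpCat.{u}).lift preadditiveYoneda
    (fun X ↦ inferInstanceAs (preadditiveYoneda.obj X).Additive)

variable {M} in
/-- There is an exact sequence `Hom(-, X) ⟶ Hom(-, Y) ⟶ F ⟶ 0` in `Mod M` whose first
morphism is induced by `f : X ⟶ Y`, i.e. `F` is a cokernel of `Hom(-, f)`. -/
def IsPresentedBy {X Y : M} (f : X ⟶ Y) (F : ModCat M) : Prop :=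
  ∃ (p : (yonedaMod M).obj Y ⟶ F) (hp : (yonedaMod M).map f ≫ p = 0),
    Nonempty (IsColimit (CokernelCofork.ofπ p hp))

/-- The finitely presented functors in `Mod M`. -/
def finitelyPresented : ObjectProperty (ModCat M) :=
  fun F ↦ ∃ (X Y : M) (f : X ⟶ Y), IsPresentedBy f F

/-- `mod M`: the full subcategory of `Mod M` of finitely presented functors. -/
abbrev FpModCat : Type (u + 1) := (finitelyPresented M).FullSubcategory

/-- `Eff(M)`: the weakly effaceable functors in `Mod M`. -/
def Eff : ObjectProperty (ModCat M) :=
  fun F ↦ ∀ (X : M) (x : F.obj.obj (op X)),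
    ∃ (Y : M) (f : Y ⟶ X), Epi f ∧ F.obj.map f.op x = 0

/-- `eff(M)`: the effaceable functors in `mod M`. -/
def eff : ObjectProperty (FpModCat M) :=
  fun F ↦ ∃ (Y X : M) (f : Y ⟶ X), Epi f ∧ IsPresentedBy f F.obj

end FunctorCategories

end DAbelian

/-!
The only consequences of the axioms of a `d`-abelian category `M` that matter are these: `M` is
additive, it has weak kernels (the last morphism of a `d`-kernel), and every epimorphism has a weak
base change which is again an epimorphism (`IsDAbelian.hasEpiLifting`; this is where it is used
that an epimorphism and its `d`-kernel form a `d`-exact sequence).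

By the last property, the sieves containing an epimorphism form a Grothendieck topology on `M`.
A morphism of `Mod M` has kernel and cokernel in `Eff(M)` exactly if it is locally bijective for
this topology, so `Mod M / Eff(M)` is the category of additive sheaves, and the quotient functor is
sheafification. In particular it has a fully faithful right adjoint (`sectionAdjunction`). Thanks
to weak kernels, being a sheaf is a condition on finitely many sections and finitely many
relations at a time, so this right adjoint preserves filtered colimits. Hence the quotient is
locally finitely presented because `Mod M` is, and its finitely presented objects are
the retracts of the images of finitely presented functors.

Weak kernels also make `mod M` an abelian subcategory of `Mod M`, closed under kernels and
cokernels, and `eff(M)` is the intersection of `mod M` with `Eff(M)`. The link between the two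
quotients is `exists_finitelyPresented_refinement`: a morphism `G ⟶ F` with `F` in `mod M` that is
invertible modulo `Eff(M)` becomes, after composition with some `F' ⟶ G`, a denominator in
`mod M`. By the calculus of fractions, `mod M / eff(M)` is therefore a full subcategory of
`Mod M / Eff(M)`, closed under kernels and cokernels. Closure under cokernels gives closure under
retracts, so that this subcategory consists of all finitely presented objects. Coherence follows:
a finitely generated subobject of a finitely presented object is the image of a morphism between
finitely presented objects, hence a kernel of a cokernel of such a morphism.
-/

namespace DAbelian

/-! ### Weak kernels and the topology of epimorphisms -/

section WeakKernels

variable {C : Type u} [Category.{v} C] [Preadditive C]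

lemma IsWeakKernel.of_iso {A B D B' D' : C} {f : A ⟶ B} {g : B ⟶ D} {g' : B' ⟶ D'}
    (h : IsWeakKernel f g) (a : B ≅ B') (b : D ≅ D') (w : a.hom ≫ g' = g ≫ b.hom) :
    IsWeakKernel (f ≫ a.hom) g' := by
  intro Y t
  have key : t ≫ g' = 0 ↔ (t ≫ a.inv) ≫ g = 0 := by
    rw [← cancel_mono b.hom, Category.assoc, Category.assoc, ← w, a.inv_hom_id_assoc, zero_comp]
  rw [key, h]
  simp [← Category.assoc, Iso.eq_comp_inv]

lemma IsWeakCokernel.of_iso {A B D B' D' : C} {f : A ⟶ B} {g : B ⟶ D} {g' : B' ⟶ D'}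
    (h : IsWeakCokernel f g) (a : B ≅ B') (b : D ≅ D') (w : a.hom ≫ g' = g ≫ b.hom) :
    IsWeakCokernel (f ≫ a.hom) g' := by
  intro Y t
  rw [Category.assoc, h]
  constructor
  · rintro ⟨s, hs⟩
    exact ⟨b.inv ≫ s, by
      rw [← cancel_epi a.hom, reassoc_of% w, b.hom_inv_id_assoc, hs]⟩
  · rintro ⟨s, rfl⟩
    exact ⟨b.hom ≫ s, by rw [reassoc_of% w]⟩

variable (C)

/-- Every morphism has a weak kernel. -/
class HasWeakKernels : Prop where
  exists_weakKernel : ∀ {A B : C} (f : A ⟶ B), ∃ (K : C) (k : K ⟶ A), IsWeakKernel k f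

/-- Epimorphisms are stable under base change, in the weak sense that an epimorphism and a
morphism with the same target complete to a commutative square in which the side opposite to
the epimorphism is an epimorphism. -/
class HasEpiLifting : Prop where
  exists_lift : ∀ {X Y Z : C} (f : Y ⟶ X) (g : Z ⟶ X), Epi f →
    ∃ (W : C) (f' : W ⟶ Z) (g' : W ⟶ Y), Epi f' ∧ f' ≫ g = g' ≫ f

variable {C} {d : ℕ}

/-- The last morphism of a `d`-kernel of `f` is a weak kernel of `f`; if `f` is an epimorphism, then
the `d`-kernel is a `d`-exact sequence, and so this morphism has `f` as a weak cokernel. -/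
lemma IsDAbelian.exists_weakKernel (hC : IsDAbelian d C) (hd : 0 < d) {A B : C} (f : A ⟶ B) :
    ∃ (K : C) (k : K ⟶ A), IsWeakKernel k f ∧ (Epi f → IsWeakCokernel k f) := by
  obtain ⟨S, hS, ⟨e⟩⟩ := hC.exists_dKernel f
  obtain ⟨n, rfl⟩ : ∃ n, d = n + 1 := ⟨d - 1, by lia⟩
  refine ⟨_, S.map' n (n + 1) ≫ e.hom.left, (hS.isWeakKernel n (by lia)).of_iso
    (Arrow.leftFunc.mapIso e) (Arrow.rightFunc.mapIso e) e.hom.w,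
    fun hf ↦ ?_⟩
  have : Epi (S.map' (n + 1) (n + 1 + 1)) :=
    ((MorphismProperty.epimorphisms C).arrow_mk_iso_iff e).2 hf
  exact ((hC.isRightDExact_of_epi S this hS).isWeakCokernel n (by lia)).of_iso
    (Arrow.leftFunc.mapIso e) (Arrow.rightFunc.mapIso e) e.hom.w

lemma IsDAbelian.hasWeakKernels (hC : IsDAbelian d C) (hd : 0 < d) : HasWeakKernels C where
  exists_weakKernel f := by
    obtain ⟨K, k, hk, -⟩ := hC.exists_weakKernel hd f
    exact ⟨K, k, hk⟩

/-- An epimorphism `f : Y ⟶ X` makes `(f, -g) : Y ⊞ Z ⟶ X` an epimorphism, which is therefore the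
cokernel of its weak kernel `(g', f')`. A morphism that vanishes on `f'` extends by zero to
`Y ⊞ Z`, hence factors through `(f, -g)`, and the factorization vanishes since it does
on `f`. -/
lemma IsDAbelian.hasEpiLifting (hC : IsDAbelian d C) (hd : 0 < d) : HasEpiLifting C where
  exists_lift {X Y Z} f g hf := by
    have := hC.hasFiniteBiproducts
    have := HasBinaryBiproducts.of_hasBinaryProducts (C := C)
    obtain ⟨K, k, hk, hk'⟩ := hC.exists_weakKernel hd (biprod.desc f (-g))
    have hepi : Epi (biprod.desc f (-g)) := by
      have : Epi (biprod.inl ≫ biprod.desc f (-g)) := by simpa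
      exact epi_of_epi biprod.inl _
    have hk0 : k ≫ biprod.desc f (-g) = 0 := (hk k).2 ⟨𝟙 _, by simp⟩
    refine ⟨K, k ≫ biprod.snd, k ≫ biprod.fst, ?_, ?_⟩
    · rw [Preadditive.epi_iff_cancel_zero]
      intro P h hh
      obtain ⟨t, ht⟩ := (hk' hepi (biprod.snd ≫ h)).1 (by simpa using hh)
      have ht0 : t = 0 := by
        rw [← cancel_epi f, comp_zero]
        simpa using biprod.inl ≫= ht
      simpa [ht0] using (biprod.inr ≫= ht).symm
    · rw [eq_comm, ← sub_eq_zero, ← hk0]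
      simp [biprod.desc_eq, sub_eq_add_neg]

/-- A weak kernel of `(f, -g) : Y ⊞ Z ⟶ X` is a weak pullback of `f` and `g`. -/
lemma exists_weakPullback [HasWeakKernels C] [HasBinaryBiproducts C] {X Y Z : C}
    (f : Y ⟶ X) (g : Z ⟶ X) :
    ∃ (P : C) (p : P ⟶ Y) (q : P ⟶ Z), p ≫ f = q ≫ g ∧
      ∀ ⦃W : C⦄ (a : W ⟶ Y) (b : W ⟶ Z), a ≫ f = b ≫ g → ∃ t : W ⟶ P, t ≫ p = a ∧ t ≫ q = b := by
  obtain ⟨K, k, hk⟩ := HasWeakKernels.exists_weakKernel (biprod.desc f (-g))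
  have hk0 : k ≫ biprod.desc f (-g) = 0 := (hk k).2 ⟨𝟙 _, by simp⟩
  refine ⟨K, k ≫ biprod.fst, k ≫ biprod.snd, ?_, fun W a b hab ↦ ?_⟩
  · rw [← sub_eq_zero, ← hk0]
    simp [biprod.desc_eq, sub_eq_add_neg]
  · obtain ⟨t, ht⟩ := (hk (biprod.lift a b)).1 (by simp [hab])
    exact ⟨t, by simp [reassoc_of% ht], by simp [reassoc_of% ht]⟩

end WeakKernels

section Topology

variable (C : Type u) [Category.{v} C] [HasEpiLifting C]

/-- The Grothendieck topology whose covering sieves are those that contain an epimorphism. -/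
def epiTopology : GrothendieckTopology C where
  sieves X := {S | ∃ (Y : C) (f : Y ⟶ X), Epi f ∧ S f}
  top_mem' X := ⟨X, 𝟙 X, inferInstance, trivial⟩
  pullback_stable' := by
    rintro X Z S g ⟨Y, f, hf, hS⟩
    obtain ⟨W, f', g', hf', h⟩ := HasEpiLifting.exists_lift f g hf
    exact ⟨W, f', hf', by simpa [h] using S.downward_closed hS g'⟩
  transitive' := by
    rintro X S ⟨Y, f, hf, hS⟩ R hR
    obtain ⟨Z, g, hg, hR⟩ := hR hS
    exact ⟨Z, g ≫ f, inferInstance, hR⟩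

variable {C}

lemma mem_epiTopology_iff {X : C} (S : Sieve X) :
    S ∈ epiTopology C X ↔ ∃ (Y : C) (f : Y ⟶ X), Epi f ∧ S f := Iff.rfl

end Topology

/-! ### The abelian category of additive presheaves, and its calculus of elements -/

section AdditiveFunctors

variable {C D : Type*} [Category* C] [Category* D] [Preadditive C] [Preadditive D]
  (J : Type*) [Category* J]

instance [HasColimitsOfShape J D] : (additiveFunctor C D).IsClosedUnderColimitsOfShape J where
  colimitsOfShape_le := by
    rintro F ⟨p⟩
    refine ⟨fun {X Y f g} ↦ ?_⟩
    refine (isColimitOfPreserves ((evaluation C D).obj X) p.isColimit).hom_ext fun j ↦ ?_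
    have := p.prop_diag_obj j
    have : (p.diag.obj j).Additive := this
    have h (k : X ⟶ Y) : (p.ι.app j).app X ≫ F.map k = (p.diag.obj j).map k ≫ (p.ι.app j).app Y :=
      ((p.ι.app j).naturality k).symm
    change (p.ι.app j).app X ≫ F.map (f + g) = (p.ι.app j).app X ≫ (F.map f + F.map g)
    rw [Preadditive.comp_add, h, h, h, Functor.map_add, Preadditive.add_comp]

instance [HasLimitsOfShape J D] : (additiveFunctor C D).IsClosedUnderLimitsOfShape J where
  limitsOfShape_le := by
    rintro F ⟨p⟩
    refine ⟨fun {X Y f g} ↦ ?_⟩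
    refine (isLimitOfPreserves ((evaluation C D).obj Y) p.isLimit).hom_ext fun j ↦ ?_
    have := p.prop_diag_obj j
    have : (p.diag.obj j).Additive := this
    have h (k : X ⟶ Y) : F.map k ≫ (p.π.app j).app Y = (p.π.app j).app X ≫ (p.diag.obj j).map k :=
      (p.π.app j).naturality k
    change F.map (f + g) ≫ (p.π.app j).app Y = (F.map f + F.map g) ≫ (p.π.app j).app Y
    rw [Preadditive.add_comp, h, h, h, Functor.map_add, Preadditive.comp_add]

end AdditiveFunctors

noncomputable section

variable {M : Type u} [SmallCategory M] [Preadditive M]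



open ZeroObject in
instance : (additiveFunctor Mᵒᵖ AddCommGrpCat.{u}).ContainsZero where
  exists_zero := ⟨0, isZero_zero _, .of_isZero (isZero_zero _)⟩

instance : (additiveFunctor Mᵒᵖ AddCommGrpCat.{u}).IsClosedUnderKernels where
  kernels_le := by
    rintro _ ⟨f, k, hk, hX, hY⟩
    exact ObjectProperty.prop_of_isLimit _ hk (by rintro (_ | _) <;> assumption)

instance : (additiveFunctor Mᵒᵖ AddCommGrpCat.{u}).IsClosedUnderCokernels where
  cokernels_le := by
    rintro _ ⟨f, k, hk, hX, hY⟩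
    exact ObjectProperty.prop_of_isColimit _ hk (by rintro (_ | _) <;> assumption)

instance : (additiveFunctor Mᵒᵖ AddCommGrpCat.{u}).IsClosedUnderFiniteProducts where

instance : HasColimitsOfSize.{u, u} (ModCat M) := ⟨fun _ _ ↦ inferInstance⟩

/-- The functor `F ↦ F(X)` on `Mod M`. -/
abbrev evalFunctor (X : M) : ModCat M ⥤ AddCommGrpCat.{u} :=
  AdditiveFunctor.forget _ _ ⋙ (evaluation Mᵒᵖ AddCommGrpCat.{u}).obj (op X)

instance (X : M) (J : Type*) [Category* J] [HasColimitsOfShape J AddCommGrpCat.{u}] :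
    PreservesColimitsOfShape J (evalFunctor X) := inferInstance
instance (X : M) (J : Type*) [Category* J] [HasLimitsOfShape J AddCommGrpCat.{u}] :
    PreservesLimitsOfShape J (evalFunctor X) := inferInstance
instance (X : M) : PreservesFiniteLimits (evalFunctor X) := ⟨fun _ _ _ ↦ inferInstance⟩
instance (X : M) : PreservesFiniteColimits (evalFunctor X) := ⟨fun _ _ _ ↦ inferInstance⟩

/-- The elements of `F(X)`. -/
abbrev sec (F : ModCat M) (X : M) : Type u := F.obj.obj (op X)

/-- The map `F(X) → F(Y)` induced by `f : Y ⟶ X`. -/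
def res (F : ModCat M) {X Y : M} (f : Y ⟶ X) : sec F X →+ sec F Y := (F.obj.map f.op).hom

/-- The map `F(X) → G(X)` induced by a morphism `F ⟶ G`. -/
def evalHom {F G : ModCat M} (φ : F ⟶ G) (X : M) : sec F X →+ sec G X := (φ.hom.app (op X)).hom

section Sections

variable (F : ModCat M) {G H : ModCat M} {X Y Z : M}

lemma res_id (x : sec F X) : res F (𝟙 X) x = x := by simp [res]

lemma res_comp (f : Y ⟶ X) (g : Z ⟶ Y) (x : sec F X) : res F (g ≫ f) x = res F g (res F f x) := by
  simp [res]

lemma res_add (f g : Y ⟶ X) (x : sec F X) : res F (f + g) x = res F f x + res F g x := by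
  have : F.obj.map (f.op + g.op) = F.obj.map f.op + F.obj.map g.op := F.obj.map_add
  simp [res, this]

lemma res_zero (x : sec F X) : res F (0 : Y ⟶ X) x = 0 := by
  simpa using res_add F (0 : Y ⟶ X) 0 x

lemma res_sub (f g : Y ⟶ X) (x : sec F X) : res F (f - g) x = res F f x - res F g x := by
  rw [eq_sub_iff_add_eq, ← res_add, sub_add_cancel]

variable {F}

lemma evalHom_res (φ : F ⟶ G) (f : Y ⟶ X) (x : sec F X) :
    evalHom φ Y (res F f x) = res G f (evalHom φ X x) :=
  NatTrans.naturality_apply φ.hom f.op x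

@[simp] lemma evalHom_comp (φ : F ⟶ G) (ψ : G ⟶ H) (x : sec F X) :
    evalHom (φ ≫ ψ) X x = evalHom ψ X (evalHom φ X x) := by simp [evalHom]

@[simp] lemma evalHom_id (x : sec F X) : evalHom (𝟙 F) X x = x := by simp [evalHom]

@[simp] lemma evalHom_zero (x : sec F X) : evalHom (0 : F ⟶ G) X x = 0 := rfl

lemma hom_ext {φ ψ : F ⟶ G} (h : ∀ X x, evalHom φ X x = evalHom ψ X x) : φ = ψ := by
  ext X x
  exact h X.unop x

/-- The morphism `Hom(-, X) ⟶ F` given by the Yoneda lemma. -/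
def ofSec (x : sec F X) : (yonedaMod M).obj X ⟶ F :=
  ObjectProperty.homMk
    { app Y := AddCommGrpCat.ofHom
        { toFun f := res F (Y := Y.unop) f x
          map_zero' := res_zero F x
          map_add' f g := res_add F f g x }
      naturality Y Z f := by
        ext g
        exact res_comp F g f.unop x }

/-- A morphism `f : Y ⟶ X` as an element of `Hom(-, X)` at `Y`. -/
def homSec (f : Y ⟶ X) : sec ((yonedaMod M).obj X) Y := f

lemma homSec_surjective (x : sec ((yonedaMod M).obj X) Y) : ∃ f, homSec f = x := ⟨x, rfl⟩

lemma homSec_injective {f g : Y ⟶ X} (h : homSec f = homSec g) : f = g := h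

lemma evalHom_ofSec (x : sec F X) (f : Y ⟶ X) : evalHom (ofSec x) Y (homSec f) = res F f x := rfl

lemma res_homSec (f : Y ⟶ X) (g : Z ⟶ Y) :
    res ((yonedaMod M).obj X) g (homSec f) = homSec (g ≫ f) := rfl

lemma evalHom_yonedaMod (f : Y ⟶ X) (g : Z ⟶ Y) :
    evalHom ((yonedaMod M).map f) Z (homSec g) = homSec (g ≫ f) := rfl

lemma ofSec_evalHom_id (φ : (yonedaMod M).obj X ⟶ F) :
    ofSec (evalHom φ X (homSec (𝟙 X))) = φ := by
  refine hom_ext fun Y x ↦ ?_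
  obtain ⟨f, rfl⟩ := homSec_surjective x
  rw [evalHom_ofSec, ← evalHom_res, res_homSec, Category.comp_id]

lemma exact_iff (S : ShortComplex (ModCat M)) :
    S.Exact ↔ ∀ (X : M) (x : sec S.X₂ X), evalHom S.g X x = 0 → ∃ y, evalHom S.f X y = x := by
  have h (X : M) : (S.map (evalFunctor X)).Exact ↔
      ∀ (x : sec S.X₂ X), evalHom S.g X x = 0 → ∃ y, evalHom S.f X y = x :=
    ShortComplex.ab_exact_iff _
  simp only [← h]
  refine ⟨fun hS X ↦ hS.map _, fun hS ↦ ?_⟩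
  rw [S.exact_iff_isZero_homology, IsZero.iff_id_eq_zero]
  refine hom_ext fun X x ↦ ?_
  have h0 : IsZero ((evalFunctor X).obj S.homology) :=
    ((ShortComplex.exact_iff_isZero_homology _).1 (hS X)).of_iso (S.mapHomologyIso _).symm
  have := AddCommGrpCat.subsingleton_of_isZero h0
  exact this.elim _ _

lemma mono_iff (φ : F ⟶ G) : Mono φ ↔ ∀ X x, evalHom φ X x = 0 → x = 0 := by
  constructor
  · intro _ X x hx
    have : Mono ((evalFunctor X).map φ) := inferInstance
    exact (AddCommGrpCat.mono_iff_injective _).1 this (hx.trans (map_zero (evalHom φ X)).symm)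
  · intro h
    refine ⟨fun {K} α β hαβ ↦ hom_ext fun X x ↦ ?_⟩
    rw [← sub_eq_zero]
    apply h
    rw [map_sub, ← evalHom_comp, ← evalHom_comp, hαβ, sub_self]

lemma epi_iff (φ : F ⟶ G) : Epi φ ↔ ∀ X, Function.Surjective (evalHom φ X) := by
  constructor
  · intro _ X
    have : Epi ((evalFunctor X).map φ) := inferInstance
    exact (AddCommGrpCat.epi_iff_surjective _).1 this
  · intro h
    refine ⟨fun {K} α β hαβ ↦ hom_ext fun X x ↦ ?_⟩
    obtain ⟨y, rfl⟩ := h X x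
    rw [← evalHom_comp, ← evalHom_comp, hαβ]

end Sections

/-! ### Morphisms inverted in the quotient by the weakly effaceable functors -/

section WeaklyEffaceable

open ZeroObject in
instance : (Eff M).IsSerreClass where
  exists_zero := by
    refine ⟨_, isZero_zero _, fun X x ↦ ⟨X, 𝟙 X, inferInstance, ?_⟩⟩
    have : Subsingleton (sec (0 : ModCat M) X) :=
      AddCommGrpCat.subsingleton_of_isZero ((evalFunctor X).map_isZero (isZero_zero _))
    exact Subsingleton.elim (α := sec (0 : ModCat M) X) _ _
  prop_of_mono {F G} φ hφ hG X x := by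
    obtain ⟨Y, f, hf, h⟩ := hG X (evalHom φ X x)
    exact ⟨Y, f, hf, (mono_iff φ).1 hφ Y _ ((evalHom_res φ f x).trans h)⟩
  prop_of_epi {F G} φ hφ hF X x := by
    obtain ⟨x, rfl⟩ := (epi_iff φ).1 hφ X x
    obtain ⟨Y, f, hf, h⟩ := hF X x
    refine ⟨Y, f, hf, ?_⟩
    change res G f (evalHom φ X x) = 0
    rw [← evalHom_res, show res F f x = 0 from h, map_zero]
  prop_X₂_of_shortExact {S} hS h₁ h₃ X x := by
    obtain ⟨Y, f, hf, h⟩ := h₃ X (evalHom S.g X x)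
    obtain ⟨y, hy⟩ := (exact_iff S).1 hS.exact Y (res S.X₂ f x) ((evalHom_res S.g f x).trans h)
    obtain ⟨Z, g, hg, h'⟩ := h₁ Y y
    refine ⟨Z, g ≫ f, inferInstance, ?_⟩
    change res S.X₂ (g ≫ f) x = 0
    rw [res_comp, ← hy, ← evalHom_res, show res S.X₁ g y = 0 from h', map_zero]

variable {F G : ModCat M} (φ : F ⟶ G)

lemma monoModSerre_Eff_iff :
    (Eff M).monoModSerre φ ↔ ∀ (X : M) (x : sec F X), evalHom φ X x = 0 →
      ∃ (Y : M) (f : Y ⟶ X), Epi f ∧ res F f x = 0 := by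
  have hex : (ShortComplex.mk _ _ (kernel.condition φ)).Exact :=
    ShortComplex.exact_of_f_is_kernel _ (kernelIsKernel φ)
  constructor
  · intro h X x hx
    obtain ⟨y, rfl⟩ := (exact_iff _).1 hex X x hx
    obtain ⟨Y, f, hf, h⟩ := h X y
    exact ⟨Y, f, hf, by rw [← evalHom_res, show res _ f y = 0 from h, map_zero]⟩
  · intro h X x
    obtain ⟨Y, f, hf, h⟩ := h X (evalHom (kernel.ι φ) X x) (by
      rw [← evalHom_comp, kernel.condition, evalHom_zero])
    exact ⟨Y, f, hf, (mono_iff (kernel.ι φ)).1 inferInstance Y _ ((evalHom_res _ _ _).trans h)⟩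

lemma epiModSerre_Eff_iff :
    (Eff M).epiModSerre φ ↔ ∀ (X : M) (x : sec G X),
      ∃ (Y : M) (f : Y ⟶ X) (y : sec F Y), Epi f ∧ evalHom φ Y y = res G f x := by
  have hex : (ShortComplex.mk _ _ (cokernel.condition φ)).Exact :=
    ShortComplex.exact_of_g_is_cokernel _ (cokernelIsCokernel φ)
  constructor
  · intro h X x
    obtain ⟨Y, f, hf, h⟩ := h X (evalHom (cokernel.π φ) X x)
    obtain ⟨y, hy⟩ := (exact_iff _).1 hex Y (res G f x) ((evalHom_res _ _ _).trans h)
    exact ⟨Y, f, y, hf, hy⟩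
  · intro h X x
    obtain ⟨x, rfl⟩ := (epi_iff (cokernel.π φ)).1 inferInstance X x
    obtain ⟨Y, f, y, hf, hy⟩ := h X x
    refine ⟨Y, f, hf, (evalHom_res (cokernel.π φ) f x).symm.trans ?_⟩
    rw [← hy, ← evalHom_comp, cokernel.condition, evalHom_zero]

/-- The morphisms that become invertible modulo `Eff(M)` are those that are locally bijective for
the topology of epimorphisms. -/
lemma isoModSerre_Eff_iff_W [HasEpiLifting M] :
    (Eff M).isoModSerre φ ↔ (epiTopology M).W φ.hom := by
  rw [GrothendieckTopology.W_iff_isLocallyBijective, ObjectProperty.isoModSerre_iff]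
  refine and_congr ?_ ?_
  · rw [monoModSerre_Eff_iff]
    constructor
    · refine fun h ↦ ⟨fun {X} x y hxy ↦ ?_⟩
      obtain ⟨Y, f, hf, h⟩ := h X.unop (x - y) ((map_sub (evalHom φ X.unop) x y).trans
        (sub_eq_zero.2 hxy))
      exact ⟨Y, f, hf, sub_eq_zero.1 ((map_sub (res F f) x y).symm.trans h)⟩
    · intro h X x hx
      obtain ⟨Y, f, hf, h⟩ := Presheaf.equalizerSieve_mem (epiTopology M) φ.hom x (0 : sec F X)
        (hx.trans (map_zero (evalHom φ X)).symm)
      exact ⟨Y, f, hf, (show res F f x = res F f 0 from h).trans (map_zero _)⟩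
  · rw [epiModSerre_Eff_iff]
    constructor
    · refine fun h ↦ ⟨fun {X} x ↦ ?_⟩
      obtain ⟨Y, f, y, hf, h⟩ := h X x
      exact ⟨Y, f, hf, y, h⟩
    · intro h X x
      obtain ⟨Y, f, hf, y, h⟩ := Presheaf.imageSieve_mem (epiTopology M) φ.hom (U := op X) x
      exact ⟨Y, f, y, hf, h⟩

end WeaklyEffaceable

/-! ### The quotient by the weakly effaceable functors is a category of sheaves -/

section Sheaves

variable (M) in
/-- The additive presheaves on `M` which are sheaves for the topology of epimorphisms. -/
def isSheafMod [HasEpiLifting M] : ObjectProperty (ModCat M) :=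
  fun F ↦ Presheaf.IsSheaf (epiTopology M) F.obj

variable [HasEpiLifting M]

/-- Since `M` is additive, the compatibility of a section `y` over `Y` with respect to
an epimorphism `f : Y ⟶ X` only involves the morphisms `a` such that `a ≫ f = 0`. -/
lemma isSheafMod_iff (F : ModCat M) :
    isSheafMod M F ↔ ∀ ⦃X Y : M⦄ (f : Y ⟶ X), Epi f →
      (∀ x : sec F X, res F f x = 0 → x = 0) ∧
      ∀ y : sec F Y, (∀ ⦃Z : M⦄ (a : Z ⟶ Y), a ≫ f = 0 → res F a y = 0) →
        ∃ x : sec F X, res F f x = y := by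
  rw [isSheafMod, Presheaf.isSheaf_iff_isSheaf_forget (s := forget AddCommGrpCat.{u}),
    isSheaf_iff_isSheaf_of_type]
  constructor
  · intro h X Y f hf
    have h' := h _ ((mem_epiTopology_iff (Sieve.generate (Presieve.singleton f))).2
      ⟨Y, f, hf, Sieve.le_generate _ _ _ (.mk)⟩)
    rw [← Presieve.isSheafFor_iff_generate, Presieve.isSheafFor_singleton] at h'
    have key (y : sec F Y) (hy : ∀ ⦃Z : M⦄ (a : Z ⟶ Y), a ≫ f = 0 → res F a y = 0) :
        ∃! x : sec F X, res F f x = y := by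
      refine h' y fun {Z} p₁ p₂ hp ↦ sub_eq_zero.1 ?_
      exact (res_sub F p₁ p₂ y).symm.trans (hy (p₁ - p₂) (by simp [hp]))
    refine ⟨fun x hx ↦ ?_, fun y hy ↦ (key y hy).exists⟩
    exact (key 0 (fun _ _ _ ↦ map_zero _)).unique hx (map_zero _)
  · rintro h X S ⟨Y, f, hf, hS⟩ s hs
    have hs' {Z W : M} (g : Z ⟶ X) (hg : S g) (k : W ⟶ Z) :
        res F k (s g hg) = s (k ≫ g) (S.downward_closed hg k) := by
      exact (hs k (𝟙 _) hg (S.downward_closed hg k) (by simp)).trans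
        (res_id F (s (k ≫ g) (S.downward_closed hg k)))
    obtain ⟨x, hx⟩ := (h f hf).2 (s f hS) (fun Z a ha ↦ by
      have h0 := hs' f hS (0 : Z ⟶ Y)
      rw [res_zero] at h0
      rw [hs', h0]
      congr 1
      simp [ha])
    refine ⟨x, fun Z g hg ↦ ?_, fun x' hx' ↦ ?_⟩
    · obtain ⟨W, f', g', hf', w⟩ := HasEpiLifting.exists_lift f g hf
      change res F g x = s g hg
      rw [← sub_eq_zero]
      refine (h f' hf').1 _ ?_
      have h1 : res F f' (res F g x) = res F g' (s f hS) := by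
        rw [← res_comp, w, res_comp, hx]
      rw [map_sub, h1, hs', hs', sub_eq_zero]
      congr 1
      exact w.symm
    · refine sub_eq_zero.1 ((h f hf).1 (show sec F X from x' - x) ?_)
      refine (map_sub (res F f) x' x).trans (sub_eq_zero.2 ?_)
      exact (hx' f hS).trans hx.symm

lemma eq_of_isSheaf_epiTopology {C : Type u} [SmallCategory C] [HasEpiLifting C]
    {G : Cᵒᵖ ⥤ AddCommGrpCat.{u}} (hG : Presheaf.IsSheaf (epiTopology C) G) {X Y : C}
    (f : Y ⟶ X) [hf : Epi f]
    {s t : G.obj (op X)} (h : G.map f.op s = G.map f.op t) : s = t := by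
  have hG' : Presieve.IsSeparated (epiTopology C) (G ⋙ forget AddCommGrpCat.{u}) :=
    Presieve.IsSheaf.isSeparated ((isSheaf_iff_isSheaf_of_type _ _).1
      ((Presheaf.isSheaf_iff_isSheaf_forget _ _ (forget AddCommGrpCat.{u})).1 hG))
  refine (hG' _ ((mem_epiTopology_iff (Sieve.generate (Presieve.singleton f))).2
      ⟨Y, f, hf, Sieve.le_generate _ _ _ .mk⟩)).ext ?_
  rintro Z _ ⟨T, c, _, ⟨⟩, rfl⟩
  change G.map (c ≫ f).op s = G.map (c ≫ f).op t
  rw [op_comp, G.map_comp, ConcreteCategory.comp_apply, ConcreteCategory.comp_apply, h]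

/-- The sheafification of an additive presheaf is additive, because locally its sections come
from the presheaf. -/
lemma additive_sheafify (F : ModCat M) : (sheafify (epiTopology M) F.obj).Additive := by
  let G := sheafify (epiTopology M) F.obj
  let η : F.obj ⟶ G := toSheafify _ _
  have nat {X Y : M} (k : Y ⟶ X) (t : sec F X) :
      η.app (op Y) (res F k t) = G.map k.op (η.app (op X) t) := NatTrans.naturality_apply η k.op t
  have hadd {X Y : M} (f g : Y ⟶ X) (s : G.obj (op X)) :
      G.map (f + g).op s = G.map f.op s + G.map g.op s := by
    obtain ⟨X', e, he, t, ht⟩ := Presheaf.imageSieve_mem (epiTopology M) η (U := op X) s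
    obtain ⟨W, a, f', ha, wf⟩ := HasEpiLifting.exists_lift e f he
    obtain ⟨V, b, g', hb, wg⟩ := HasEpiLifting.exists_lift e (a ≫ g) he
    have key {k : Y ⟶ X} {k' : V ⟶ X'} (w : (b ≫ a) ≫ k = k' ≫ e) :
        G.map (b ≫ a).op (G.map k.op s) = η.app (op V) (res F k' t) := by
      rw [nat, show η.app (op X') t = G.map e.op s from ht, ← ConcreteCategory.comp_apply,
        ← ConcreteCategory.comp_apply, ← G.map_comp, ← G.map_comp, ← op_comp, ← op_comp, w]
    apply eq_of_isSheaf_epiTopology ((presheafToSheaf (epiTopology M) _).obj F.obj).property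
      (b ≫ a)
    have hf : (b ≫ a) ≫ f = (b ≫ f') ≫ e := by simp [wf]
    have hg : (b ≫ a) ≫ g = g' ≫ e := by simpa using wg
    rw [map_add, key hf, key hg, key (k' := b ≫ f' + g') (by
      rw [Preadditive.comp_add, Preadditive.add_comp, hf, hg]), res_add, map_add]
  refine ⟨fun {X Y f g} ↦ ?_⟩
  ext s
  exact hadd f.unop g.unop s

/-- Sections of a filtered colimit are represented at some stage, and compatibility of a section
is tested on the single relation given by a weak kernel. -/
instance [HasWeakKernels M] (J : Type u) [SmallCategory J] [IsFiltered J] :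
    (isSheafMod M).IsClosedUnderColimitsOfShape J where
  colimitsOfShape_le := by
    rintro F ⟨p⟩
    have hc (X : M) : IsColimit ((evalFunctor X).mapCocone p.cocone) :=
      isColimitOfPreserves _ p.isColimit
    have rep (X : M) (x : sec F X) : ∃ (j : J) (y : sec (p.diag.obj j) X),
        evalHom (p.ι.app j) X y = x := Concrete.isColimit_exists_rep _ (hc X) x
    have eq0 (X : M) (j : J) (y : sec (p.diag.obj j) X) (hy : evalHom (p.ι.app j) X y = 0) :
        ∃ (k : J) (a : j ⟶ k), evalHom (p.diag.map a) X y = 0 := by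
      obtain ⟨k, a, b, h⟩ := Concrete.isColimit_exists_of_rep_eq _ (hc X) y
        (0 : sec (p.diag.obj j) X) (hy.trans (map_zero (evalHom (p.ι.app j) X)).symm)
      exact ⟨k, a, h.trans (map_zero (evalHom (p.diag.map b) X))⟩
    have hι {j k : J} (a : j ⟶ k) (X : M) (y : sec (p.diag.obj j) X) :
        evalHom (p.ι.app k) X (evalHom (p.diag.map a) X y) = evalHom (p.ι.app j) X y := by
      rw [← evalHom_comp]
      congr 2
      exact p.cocone.w a
    rw [isSheafMod_iff]
    intro X Y f hf
    constructor
    · intro x hx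
      obtain ⟨j, x, rfl⟩ := rep X x
      obtain ⟨k, a, h⟩ := eq0 Y j (res _ f x) (by rwa [evalHom_res])
      rw [evalHom_res] at h
      rw [← hι a, ((isSheafMod_iff _).1 (p.prop_diag_obj k) f hf).1 _ h, map_zero]
    · intro y hy
      obtain ⟨K, k, hk⟩ := HasWeakKernels.exists_weakKernel f
      obtain ⟨j, y, rfl⟩ := rep Y y
      obtain ⟨l, a, h⟩ := eq0 K j (res _ k y) (by
        rw [evalHom_res]
        exact hy k ((hk k).2 ⟨𝟙 _, by simp⟩))
      rw [evalHom_res] at h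
      obtain ⟨x, hx⟩ := ((isSheafMod_iff _).1 (p.prop_diag_obj l) f hf).2 _ (fun Z b hb ↦ by
        obtain ⟨t, rfl⟩ := (hk b).1 hb
        rw [res_comp, h, map_zero])
      exact ⟨evalHom (p.ι.app l) X x, by rw [← evalHom_res, hx, hι]⟩

variable (M)

/-- The inclusion of the additive sheaves into all sheaves. -/
def sheafModToSheaf : (isSheafMod M).FullSubcategory ⥤ Sheaf (epiTopology M) AddCommGrpCat.{u} :=
  ObjectProperty.lift _ ((isSheafMod M).ι ⋙ AdditiveFunctor.forget _ _) fun F ↦ F.property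

/-- The inclusion of the additive sheaves into all sheaves is fully faithful. -/
def fullyFaithfulSheafModToSheaf : (sheafModToSheaf M).FullyFaithful :=
  Functor.FullyFaithful.ofCompFaithful (G := sheafToPresheaf _ _)
    ((isSheafMod M).fullyFaithfulι.comp (ObjectProperty.fullyFaithfulι _))

/-- The sheafification of additive presheaves. -/
def sheafifyMod : ModCat M ⥤ (isSheafMod M).FullSubcategory :=
  ObjectProperty.lift _ (ObjectProperty.lift _
    (AdditiveFunctor.forget _ _ ⋙ presheafToSheaf (epiTopology M) _ ⋙ sheafToPresheaf _ _)
      additive_sheafify) fun F ↦ ((presheafToSheaf (epiTopology M) _).obj F.obj).property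

/-- The sheafification of additive presheaves is left adjoint to the inclusion. -/
def sheafifyModAdjunction : sheafifyMod M ⊣ (isSheafMod M).ι :=
  (sheafificationAdjunction (epiTopology M) AddCommGrpCat.{u}).restrictFullyFaithful
    (ObjectProperty.fullyFaithfulι _) (fullyFaithfulSheafModToSheaf M)
    (Iso.refl _) (Iso.refl _)

/-- Hence the category of additive sheaves is the quotient of `Mod M` by `Eff(M)`. -/
instance : (sheafifyMod M).IsLocalization (Eff M).isoModSerre := by
  convert (sheafifyModAdjunction M).isLocalization using 1
  ext F G φ
  rw [isoModSerre_Eff_iff_W, GrothendieckTopology.W_iff]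
  have : IsIso ((sheafifyMod M).map φ) ↔
      IsIso ((sheafModToSheaf M).map ((sheafifyMod M).map φ)) := by
    have := (fullyFaithfulSheafModToSheaf M).full
    have := (fullyFaithfulSheafModToSheaf M).faithful
    exact (isIso_iff_of_reflects_iso _ _).symm
  exact this.symm

end Sheaves

/-! ### The abelian category of finitely presented functors -/

section FinitelyPresented

variable {F G H : ModCat M} {X Y Z : M}

/-- The section `ξ` of `F` over `Y` generates `F`, i.e. `Hom(-, Y) ⟶ F` is an epimorphism. -/
def Generates (ξ : sec F Y) : Prop :=
  ∀ ⦃Z : M⦄ (z : sec F Z), ∃ t : Z ⟶ Y, res F t ξ = z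

/-- The morphisms annihilating the section `ξ` of `F` over `Y` are those that factor through `k`,
i.e. `Hom(-, X) ⟶ Hom(-, Y) ⟶ F` is exact. -/
def AnnihilatedBy (k : X ⟶ Y) (ξ : sec F Y) : Prop :=
  ∀ ⦃Z : M⦄ (x : Z ⟶ Y), res F x ξ = 0 ↔ ∃ t : Z ⟶ X, t ≫ k = x

lemma exact_ofSec_iff (k : X ⟶ Y) (ξ : sec F Y) (h : (yonedaMod M).map k ≫ ofSec ξ = 0) :
    (ShortComplex.mk _ _ h).Exact ↔ AnnihilatedBy k ξ := by
  rw [exact_iff]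
  constructor
  · intro hex Z x
    constructor
    · intro hx
      obtain ⟨t, ht⟩ := hex Z (homSec x) hx
      obtain ⟨t, rfl⟩ := homSec_surjective t
      exact ⟨t, homSec_injective ht⟩
    · rintro ⟨t, rfl⟩
      have := congr_arg (fun φ ↦ evalHom φ Z (homSec t)) h
      exact this
  · intro hk Z x hx
    obtain ⟨x, rfl⟩ := homSec_surjective x
    obtain ⟨t, rfl⟩ := (hk x).1 hx
    exact ⟨homSec t, rfl⟩

lemma epi_ofSec_iff (ξ : sec F Y) : Epi (ofSec ξ) ↔ Generates ξ := by
  rw [epi_iff]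
  exact forall_congr' fun Z ↦ forall_congr' fun z ↦ Iff.rfl

lemma AnnihilatedBy.yonedaMod_map_comp {k : X ⟶ Y} {ξ : sec F Y} (h : AnnihilatedBy k ξ) :
    (yonedaMod M).map k ≫ ofSec ξ = 0 := by
  refine hom_ext fun Z t ↦ ?_
  obtain ⟨t, rfl⟩ := homSec_surjective t
  rw [evalHom_comp, evalHom_yonedaMod, evalHom_ofSec, (h _).2 ⟨t, rfl⟩]
  rfl

lemma isPresentedBy_iff (f : X ⟶ Y) (F : ModCat M) :
    IsPresentedBy f F ↔ ∃ ξ : sec F Y, Generates ξ ∧ AnnihilatedBy f ξ := by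
  constructor
  · rintro ⟨p, hp, ⟨hc⟩⟩
    obtain ⟨ξ, rfl⟩ : ∃ ξ, ofSec ξ = p := ⟨_, ofSec_evalHom_id p⟩
    exact ⟨ξ, (epi_ofSec_iff ξ).1 (Cofork.IsColimit.epi hc),
      (exact_ofSec_iff f ξ hp).1 (ShortComplex.exact_of_g_is_cokernel _ hc)⟩
  · rintro ⟨ξ, hξ, hf⟩
    have : Epi (ofSec ξ) := (epi_ofSec_iff ξ).2 hξ
    refine ⟨ofSec ξ, hf.yonedaMod_map_comp, ⟨?_⟩⟩
    have : Epi (ShortComplex.mk _ _ hf.yonedaMod_map_comp).g := this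
    exact ((exact_ofSec_iff f ξ hf.yonedaMod_map_comp).2 hf).gIsCokernel

variable [HasWeakKernels M] [HasBinaryBiproducts M]

/-- If a functor has a finite presentation, then any of its sections has a finitely
generated annihilator: this is the coherence of the functors `Hom(-, X)`. -/
lemma finitelyPresented_iff (F : ModCat M) :
    finitelyPresented M F ↔ (∃ (Y : M) (ξ : sec F Y), Generates ξ) ∧
      ∀ (Y : M) (ξ : sec F Y), ∃ (X : M) (k : X ⟶ Y), AnnihilatedBy k ξ := by
  constructor
  · rintro ⟨A, B, f, hf⟩
    obtain ⟨η, hη, hf⟩ := (isPresentedBy_iff f F).1 hf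
    refine ⟨⟨B, η, hη⟩, fun Y ξ ↦ ?_⟩
    obtain ⟨g, rfl⟩ := hη ξ
    obtain ⟨P, p, q, w, hP⟩ := exists_weakPullback g f
    refine ⟨P, p, fun Z x ↦ ?_⟩
    rw [← res_comp, hf]
    constructor
    · rintro ⟨t, ht⟩
      obtain ⟨s, hs, -⟩ := hP x t ht.symm
      exact ⟨s, hs⟩
    · rintro ⟨t, rfl⟩
      exact ⟨t ≫ q, by simp [w]⟩
  · rintro ⟨⟨Y, ξ, hξ⟩, h⟩
    obtain ⟨X, k, hk⟩ := h Y ξ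
    exact ⟨X, Y, k, (isPresentedBy_iff k F).2 ⟨ξ, hξ, hk⟩⟩

/-- The kernel of `φ : F ⟶ G` is generated by the restriction of a generator `ξ` of `F` along the
morphism that generates the annihilator of `φ ξ`. -/
instance : (finitelyPresented M).IsClosedUnderKernels where
  kernels_le := by
    rintro _ ⟨φ, c, hc, hF, hG⟩
    rename_i F G
    rw [finitelyPresented_iff] at hF hG ⊢
    let ι : c.pt ⟶ F := c.ι
    have : Mono ι := Fork.IsLimit.mono hc
    have hι : ι ≫ φ = 0 := KernelFork.condition c
    have hex : (ShortComplex.mk ι φ hι).Exact :=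
      ShortComplex.exact_of_f_is_kernel _
        (hc.ofIsoLimit (Fork.ext (Iso.refl _) (by simp [ι])))
    obtain ⟨⟨Y, ξ, hξ⟩, hF⟩ := hF
    obtain ⟨D, k, hk⟩ := hG.2 Y (evalHom φ Y ξ)
    have hinj {Z : M} {a b : sec c.pt Z} (h : evalHom ι Z a = evalHom ι Z b) : a = b :=
      sub_eq_zero.1 ((mono_iff ι).1 ‹_› Z _ (by rw [map_sub, h, sub_self]))
    constructor
    · obtain ⟨η, hη⟩ := (exact_iff _).1 hex D (res F k ξ) (by
        refine (evalHom_res φ k ξ).trans ((hk k).2 ⟨𝟙 _, by simp⟩))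
      replace hη : evalHom ι D η = res F k ξ := hη
      refine ⟨D, η, fun Z z ↦ ?_⟩
      obtain ⟨x, hx⟩ := hξ (evalHom ι Z z)
      obtain ⟨t, rfl⟩ := (hk x).1 (by
        rw [← evalHom_res, hx, ← evalHom_comp, hι, evalHom_zero])
      exact ⟨t, hinj (by rw [evalHom_res, hη, ← res_comp, hx])⟩
    · intro Z z
      obtain ⟨X, k, hk⟩ := hF Z (evalHom ι Z z)
      refine ⟨X, k, fun W x ↦ (Iff.trans ?_ (hk x))⟩
      rw [← evalHom_res]
      exact ⟨fun h ↦ by rw [h, map_zero], fun h ↦ hinj (by rw [h, map_zero])⟩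

/-- A section of `coker φ`, for `φ : F ⟶ G`, is annihilated by `a` if and only if there is some `b`
such that `(a, b)` annihilates the difference of a lift to `G` and the image of a generator
of `F`. -/
instance : (finitelyPresented M).IsClosedUnderCokernels where
  cokernels_le := by
    rintro _ ⟨φ, c, hc, hF, hG⟩
    rename_i F G
    rw [finitelyPresented_iff] at hF hG ⊢
    let π : G ⟶ c.pt := c.π
    have : Epi π := Cofork.IsColimit.epi hc
    have hsurj := (epi_iff π).1 this
    have hπ : φ ≫ π = 0 := CokernelCofork.condition c
    have hex : (ShortComplex.mk φ π hπ).Exact :=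
      ShortComplex.exact_of_g_is_cokernel _
        (hc.ofIsoColimit (Cofork.ext (Iso.refl _) (by simp [π])))
    obtain ⟨⟨B, θ, hθ⟩, -⟩ := hF
    obtain ⟨⟨Y, η, hη⟩, hG⟩ := hG
    constructor
    · refine ⟨Y, evalHom π Y η, fun Z z ↦ ?_⟩
      obtain ⟨z, rfl⟩ := hsurj Z z
      obtain ⟨t, rfl⟩ := hη z
      exact ⟨t, (evalHom_res π t η).symm⟩
    · intro Z z
      obtain ⟨z, rfl⟩ := hsurj Z z
      obtain ⟨D, k, hk⟩ := hG (Z ⊞ B)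
        (res G biprod.fst z - res G biprod.snd (evalHom φ B θ))
      have hk' {W : M} (a : W ⟶ Z) (b : W ⟶ B) :
          res G a z = evalHom φ W (res _ b θ) ↔ ∃ t, t ≫ k = biprod.lift a b := by
        rw [← hk, map_sub, ← res_comp, ← res_comp, biprod.lift_fst, biprod.lift_snd, sub_eq_zero,
          evalHom_res]
      refine ⟨D, k ≫ biprod.fst, fun W x ↦ ?_⟩
      rw [← evalHom_res]
      constructor
      · intro hx
        obtain ⟨y, hy⟩ := (exact_iff _).1 hex W _ hx
        obtain ⟨b, rfl⟩ := hθ y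
        obtain ⟨t, ht⟩ := (hk' x b).1 hy.symm
        exact ⟨t, by rw [reassoc_of% ht, biprod.lift_fst]⟩
      · rintro ⟨t, rfl⟩
        rw [(hk' (t ≫ k ≫ biprod.fst) (t ≫ k ≫ biprod.snd)).2
          ⟨t, by ext <;> simp⟩, ← evalHom_comp, hπ, evalHom_zero]

end FinitelyPresented

instance : (yonedaMod M).Additive where
  map_add := hom_ext fun _ x ↦ Preadditive.comp_add _ _ _ x _ _

section FinitelyPresentedAbelian

lemma finitelyPresented_yonedaMod (X : M) : finitelyPresented M ((yonedaMod M).obj X) := by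
  refine ⟨X, X, 0, (isPresentedBy_iff _ _).2 ⟨homSec (𝟙 X), fun Z z ↦ ⟨z, ?_⟩, fun Z x ↦ ?_⟩⟩
  · exact (res_homSec _ _).trans (congr_arg homSec (Category.comp_id z))
  · rw [res_homSec, Category.comp_id]
    exact ⟨fun h ↦ ⟨0, by rw [zero_comp]; exact h.symm⟩, by rintro ⟨t, rfl⟩; rw [comp_zero]; rfl⟩

variable [HasWeakKernels M] [HasBinaryBiproducts M]

instance : (finitelyPresented M).IsClosedUnderIsomorphisms where
  of_iso e := by
    rintro ⟨X, Y, f, p, hp, ⟨hc⟩⟩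
    exact ⟨X, Y, f, p ≫ e.hom, by rw [reassoc_of% hp, zero_comp],
      ⟨IsColimit.ofIsoColimit hc (Cofork.ext e)⟩⟩

open ZeroObject in
instance [HasZeroObject M] : (finitelyPresented M).ContainsZero where
  exists_zero := ⟨(yonedaMod M).obj 0, (yonedaMod M).map_isZero (isZero_zero M),
    finitelyPresented_yonedaMod 0⟩

instance : (finitelyPresented M).IsClosedUnderBinaryProducts where
  limitsOfShape_le := by
    rintro F ⟨p⟩
    let A := p.diag.obj ⟨.left⟩
    let B := p.diag.obj ⟨.right⟩
    have hA : finitelyPresented M A := p.prop_diag_obj _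
    have hB : finitelyPresented M B := p.prop_diag_obj _
    let c : BinaryFan A B := (Cone.postcompose (diagramIsoPair p.diag).hom).obj p.cone
    have hc : IsLimit c := (IsLimit.postcomposeHomEquiv _ _).symm p.isLimit
    let a : F ⟶ A := c.fst
    let b : F ⟶ B := c.snd
    -- the inclusions of the two summands
    obtain ⟨i, (hia : i ≫ a = _), (hib : i ≫ b = _)⟩ := BinaryFan.IsLimit.lift' hc (𝟙 A) 0
    obtain ⟨j, (hja : j ≫ a = _), (hjb : j ≫ b = _)⟩ := BinaryFan.IsLimit.lift' hc 0 (𝟙 B)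
    have hij : a ≫ i + b ≫ j = 𝟙 F := by
      refine BinaryFan.IsLimit.hom_ext hc ?_ ?_
      · change (a ≫ i + b ≫ j) ≫ a = 𝟙 F ≫ a
        simp [hia, hja]
      · change (a ≫ i + b ≫ j) ≫ b = 𝟙 F ≫ b
        simp [hib, hjb]
    have inj {Z : M} (z z' : sec F Z) (h : evalHom a Z z = evalHom a Z z')
        (h' : evalHom b Z z = evalHom b Z z') : z = z' := by
      have hz (z : sec F Z) : evalHom i Z (evalHom a Z z) + evalHom j Z (evalHom b Z z) = z := by
        rw [← evalHom_comp, ← evalHom_comp]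
        exact congr_arg (fun φ ↦ evalHom φ Z z) hij
      rw [← hz z, ← hz z', h, h']
    have surj {Z : M} (x : sec A Z) (y : sec B Z) :
        ∃ z, evalHom a Z z = x ∧ evalHom b Z z = y :=
      ⟨evalHom i Z x + evalHom j Z y, by simp [← evalHom_comp, hia, hja],
        by simp [← evalHom_comp, hib, hjb]⟩
    rw [finitelyPresented_iff] at hA hB ⊢
    obtain ⟨⟨Y, ξ, hξ⟩, hA⟩ := hA
    obtain ⟨⟨Z, η, hη⟩, hB⟩ := hB
    constructor
    · obtain ⟨ζ, h1, h2⟩ := surj (res A (biprod.fst : Y ⊞ Z ⟶ Y) ξ) (res B biprod.snd η)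
      refine ⟨Y ⊞ Z, ζ, fun W w ↦ ?_⟩
      obtain ⟨s, hs⟩ := hξ (evalHom a W w)
      obtain ⟨t, ht⟩ := hη (evalHom b W w)
      refine ⟨biprod.lift s t, inj _ _ ?_ ?_⟩
      · rw [evalHom_res, h1, ← res_comp, biprod.lift_fst, hs]
      · rw [evalHom_res, h2, ← res_comp, biprod.lift_snd, ht]
    · intro W w
      obtain ⟨X, k, hk⟩ := hA W (evalHom a W w)
      obtain ⟨X', k', hk'⟩ := hB X (res B k (evalHom b W w))
      refine ⟨X', k' ≫ k, fun V x ↦ ?_⟩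
      have : res F x w = 0 ↔ res A x (evalHom a W w) = 0 ∧ res B x (evalHom b W w) = 0 := by
        rw [← evalHom_res, ← evalHom_res]
        exact ⟨fun h ↦ by simp [h], fun h ↦ inj _ _ (by simp [h]) (by simp [h])⟩
      rw [this, hk]
      constructor
      · rintro ⟨⟨t, rfl⟩, h⟩
        rw [res_comp] at h
        obtain ⟨s, rfl⟩ := (hk' t).1 h
        exact ⟨s, by simp⟩
      · rintro ⟨t, rfl⟩
        refine ⟨⟨t ≫ k', by simp⟩, ?_⟩
        rw [← Category.assoc, res_comp]
        exact (hk' _).2 ⟨t, rfl⟩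

instance [HasZeroObject M] : (finitelyPresented M).IsClosedUnderFiniteProducts :=
  .mk'

instance [HasZeroObject M] : PreservesFiniteLimits (finitelyPresented M).ι := by
  have h := (finitelyPresented M).ι.preservesFiniteLimits_tfae.out 3 2
  exact h.2 (fun _ _ f ↦ by have := (finitelyPresented M).preservesKernels_ι; infer_instance)

instance [HasZeroObject M] : PreservesFiniteColimits (finitelyPresented M).ι := by
  have h := (finitelyPresented M).ι.preservesFiniteColimits_tfae.out 3 2
  exact h.2 (fun _ _ f ↦ by have := (finitelyPresented M).preservesCokernels_ι; infer_instance)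

end FinitelyPresentedAbelian

/-! ### Effaceable functors -/

section Effaceable

variable [HasEpiLifting M]

/-- A finitely presented functor is effaceable if and only if it is weakly effaceable: if its
generator over `X` is killed by an epimorphism, then the presenting morphism `f : Y ⟶ X` is an
epimorphism, since the former factors through it. -/
lemma eff_eq_inverseImage : eff M = (Eff M).inverseImage (finitelyPresented M).ι := by
  ext ⟨F, hF⟩
  constructor
  · rintro ⟨Y, X, f, hf, h⟩ Z z
    obtain ⟨ξ, hξ, hf⟩ := (isPresentedBy_iff _ _).1 h
    obtain ⟨t, rfl⟩ := hξ z
    obtain ⟨W, f', t', _, w⟩ := HasEpiLifting.exists_lift f t ‹_›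
    refine ⟨W, f', ‹_›, ?_⟩
    exact (res_comp F t f' ξ).symm.trans ((hf _).2 ⟨t', w.symm⟩)
  · intro h
    obtain ⟨Y, X, f, hf⟩ := hF
    obtain ⟨ξ, hξ, hk⟩ := (isPresentedBy_iff _ _).1 hf
    obtain ⟨W, g, _, hg⟩ := h X ξ
    obtain ⟨t, rfl⟩ := (hk g).1 hg
    exact ⟨Y, X, f, epi_of_epi t f, hf⟩

variable [HasWeakKernels M] [HasBinaryBiproducts M] [HasZeroObject M]

instance : (eff M).IsSerreClass := by
  rw [eff_eq_inverseImage]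
  infer_instance

lemma isoModSerre_eff_iff {F G : FpModCat M} (φ : F ⟶ G) :
    (eff M).isoModSerre φ ↔ (Eff M).isoModSerre φ.hom := by
  simp_rw [ObjectProperty.isoModSerre_iff, ObjectProperty.monoModSerre_iff,
    ObjectProperty.epiModSerre_iff, eff_eq_inverseImage]
  exact and_congr
    ((Eff M).prop_iff_of_iso (PreservesKernel.iso (finitelyPresented M).ι φ))
    ((Eff M).prop_iff_of_iso (PreservesCokernel.iso (finitelyPresented M).ι φ))

end Effaceable

/-! ### `Mod M` is locally finitely presentable -/

attribute [local instance] Cardinal.fact_isRegular_aleph0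

open Cardinal

section LocallyFinitelyPresentable

/-- By the Yoneda lemma, `Hom(yonedaMod X, F)` is `F(X)`. -/
def coyonedaYonedaModIso (X : M) :
    evalFunctor X ⋙ forget AddCommGrpCat.{u} ≅ coyoneda.obj (op ((yonedaMod M).obj X)) :=
  NatIso.ofComponents (fun F ↦
    { hom := ↾ (fun x : sec F X ↦ ofSec x)
      inv := ↾ (fun φ ↦ evalHom φ X (homSec (𝟙 X)))
      hom_inv_id := by
        ext x
        exact (evalHom_ofSec _ _).trans (res_id _ _)
      inv_hom_id := by
        ext φ
        exact ofSec_evalHom_id φ }) (fun {F G} φ ↦ by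
        ext x
        refine hom_ext fun Z f ↦ ?_
        obtain ⟨f, rfl⟩ := homSec_surjective f
        exact (evalHom_res φ f x).symm)

instance (X : M) : IsFinitelyPresentable.{u} ((yonedaMod M).obj X) := by
  rw [isFinitelyPresentable_iff_preservesFilteredColimitsOfSize]
  exact ⟨fun _ _ _ ↦ preservesColimitsOfShape_of_natIso (coyonedaYonedaModIso X)⟩

variable (M) in
lemma isStrongGenerator_yonedaMod :
    (ObjectProperty.ofObj (yonedaMod M).obj).IsStrongGenerator := by
  rw [ObjectProperty.isStrongGenerator_iff]
  constructor
  · intro F G φ ψ h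
    refine hom_ext fun X x ↦ ?_
    have := h _ (ObjectProperty.ofObj_apply _ X) (ofSec x)
    have := congr_arg (fun α ↦ evalHom α X (homSec (𝟙 X))) this
    simpa [evalHom_ofSec, res_id] using this
  · intro F G φ _ h
    have : Epi φ := by
      rw [epi_iff]
      intro X x
      obtain ⟨ψ, hψ⟩ := h _ (ObjectProperty.ofObj_apply _ X) (ofSec x)
      have := congr_arg (fun α ↦ evalHom α X (homSec (𝟙 X))) hψ
      exact ⟨_, by simpa [evalHom_ofSec, res_id] using this⟩
    exact isIso_of_mono_of_epi φ

lemma ofObj_yonedaMod_le :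
    ObjectProperty.ofObj (yonedaMod M).obj ≤ isCardinalPresentable.{u} (ModCat M) ℵ₀ := by
  rintro _ ⟨X⟩
  exact inferInstanceAs (IsFinitelyPresentable.{u} ((yonedaMod M).obj X))

instance : IsCardinalLocallyPresentable.{u} (ModCat M) ℵ₀ := by
  rw [IsCardinalLocallyPresentable.iff_exists_isStrongGenerator]
  exact ⟨_, inferInstance, isStrongGenerator_yonedaMod M, ofObj_yonedaMod_le⟩

variable (M) in
/-- The two meanings of finitely presented agree on `Mod M`: both classes are the closure of the
representable functors under finite colimits. -/
lemma isFinitelyPresentable_eq_finitelyPresented [HasWeakKernels M] [HasBinaryBiproducts M]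
    [HasZeroObject M] :
    ObjectProperty.isFinitelyPresentable.{u} (ModCat M) = finitelyPresented M := by
  apply le_antisymm
  · rw [ObjectProperty.isFinitelyPresentable_eq_isCardinalPresentable,
      IsStrongGenerator.colimitsCardinalClosure_eq_isCardinalPresentable
        (isStrongGenerator_yonedaMod M) ofObj_yonedaMod_le]
    refine ObjectProperty.colimitsCardinalClosure_le _ _ (fun J _ hJ ↦ ?_) ?_
    · rw [hasCardinalLT_aleph0_iff] at hJ
      obtain ⟨_⟩ := (Arrow.finite_iff J).1 hJ
      exact ObjectProperty.isClosedUnderColimitsOfShape_of_preservesColimitsOfShape_ι _ _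
    · rintro _ ⟨X⟩
      exact finitelyPresented_yonedaMod X
  · rintro F ⟨X, Y, f, p, hp, ⟨hc⟩⟩
    have := isClosedUnderColimitsOfShape_isCardinalPresentable (ModCat M)
      (J := WalkingParallelPair) (κ := ℵ₀) (by
        rw [hasCardinalLT_aleph0_iff]; infer_instance)
    rw [ObjectProperty.isFinitelyPresentable_eq_isCardinalPresentable]
    refine ObjectProperty.prop_of_isColimit _ hc ?_
    rintro (_ | _) <;> exact ofObj_yonedaMod_le _ (ObjectProperty.ofObj_apply _ _)

end LocallyFinitelyPresentable

/-! ### Localizations of full subcategories -/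

section FullyFaithful

variable {C₁ C₂ D₁ D₂ : Type*} [Category* C₁] [Category* C₂] [Category* D₁] [Category* D₂]
  {ι : C₁ ⥤ C₂} [ι.Full] {W₂ : MorphismProperty C₂} [W₂.HasRightCalculusOfFractions]

/-- The source of a fraction between objects of a full subcategory may be taken in that
subcategory, as soon as every denominator can be refined to one whose source is in the
subcategory. -/
lemma exists_fraction_of_refinement (L₂ : C₂ ⥤ D₂) [L₂.IsLocalization W₂]
    (h : ∀ ⦃X : C₁⦄ ⦃Z : C₂⦄ (s : Z ⟶ ι.obj X), W₂ s →
      ∃ (X' : C₁) (t : ι.obj X' ⟶ Z), W₂ (t ≫ s))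
    {X Y : C₁} (a : L₂.obj (ι.obj X) ⟶ L₂.obj (ι.obj Y)) :
    ∃ (X' : C₁) (s : X' ⟶ X) (f : X' ⟶ Y), W₂ (ι.map s) ∧
      L₂.map (ι.map s) ≫ a = L₂.map (ι.map f) := by
  obtain ⟨φ, rfl⟩ := Localization.exists_rightFraction L₂ W₂ a
  obtain ⟨X', t, ht⟩ := h φ.s φ.hs
  refine ⟨X', ι.preimage (t ≫ φ.s), ι.preimage (t ≫ φ.f), by simpa using ht, ?_⟩
  simp [φ.map_s_comp_map]

/-- Let a full subcategory `C₁` of `C₂` be such that every denominator of `C₂` with target in `C₁`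
can be refined to one with source in `C₁`. Then the localization of `C₁` is a full subcategory of
the localization of `C₂`. -/
lemma full_faithful_of_refinement [ι.Faithful] (L₁ : C₁ ⥤ D₁) (L₂ : C₂ ⥤ D₂)
    (W₁ : MorphismProperty C₁) [W₁.HasRightCalculusOfFractions]
    [L₁.IsLocalization W₁] [L₂.IsLocalization W₂]
    (hW : ∀ ⦃X Y : C₁⦄ (f : X ⟶ Y), W₁ f ↔ W₂ (ι.map f))
    (h : ∀ ⦃X : C₁⦄ ⦃Z : C₂⦄ (s : Z ⟶ ι.obj X), W₂ s →
      ∃ (X' : C₁) (t : ι.obj X' ⟶ Z), W₂ (t ≫ s))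
    (Φ : D₁ ⥤ D₂) (e : L₁ ⋙ Φ ≅ ι ⋙ L₂) : Φ.Full ∧ Φ.Faithful := by
  have := Localization.essSurj L₁ W₁
  have nat {X Y : C₁} (f : X ⟶ Y) :
      Φ.map (L₁.map f) = e.hom.app X ≫ L₂.map (ι.map f) ≫ e.inv.app Y :=
    (NatIso.naturality_2 e f).symm
  constructor
  · constructor
    intro A B a
    let a' := e.inv.app _ ≫ Φ.map (L₁.objObjPreimageIso A).hom ≫ a ≫
      Φ.map (L₁.objObjPreimageIso B).inv ≫ e.hom.app _
    obtain ⟨X', s, f, hs, hf⟩ := exists_fraction_of_refinement L₂ h a'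
    have : IsIso (L₁.map s) := Localization.inverts L₁ W₁ s ((hW s).2 hs)
    refine ⟨(L₁.objObjPreimageIso A).inv ≫ inv (L₁.map s) ≫ L₁.map f ≫
      (L₁.objObjPreimageIso B).hom, ?_⟩
    have key : Φ.map (inv (L₁.map s)) ≫ Φ.map (L₁.map f) = e.hom.app _ ≫ a' ≫ e.inv.app _ := by
      rw [Functor.map_inv, IsIso.inv_comp_eq, nat, nat, ← hf]
      simp
    simp only [Functor.map_comp]
    rw [reassoc_of% key]
    simp [a', ← Functor.map_comp, ← Functor.map_comp_assoc]
  · constructor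
    intro A B a b hab
    let α := L₁.objObjPreimageIso A
    let β := L₁.objObjPreimageIso B
    -- `a` and `b` are given a common denominator
    obtain ⟨φ, hφ⟩ := Localization.exists_rightFraction L₁ W₁ (α.hom ≫ a ≫ β.inv)
    obtain ⟨ψ, hψ⟩ := Localization.exists_rightFraction L₁ W₁ (L₁.map φ.s ≫ α.hom ≫ b ≫ β.inv)
    have ha : L₁.map (ψ.s ≫ φ.s) ≫ α.hom ≫ a ≫ β.inv = L₁.map (ψ.s ≫ φ.f) := by
      rw [hφ, Functor.map_comp, Category.assoc, φ.map_s_comp_map, Functor.map_comp]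
    have hb : L₁.map (ψ.s ≫ φ.s) ≫ α.hom ≫ b ≫ β.inv = L₁.map ψ.f := by
      rw [Functor.map_comp, Category.assoc, hψ, ψ.map_s_comp_map]
    have hΦ : Φ.map (L₁.map (ψ.s ≫ φ.f)) = Φ.map (L₁.map ψ.f) := by
      rw [← ha, ← hb]
      simp only [Functor.map_comp, hab]
    rw [nat, nat, cancel_epi, cancel_mono, MorphismProperty.map_eq_iff_precomp L₂ W₂] at hΦ
    obtain ⟨Z, t, ht, hZ⟩ := hΦ
    obtain ⟨X', r, hr⟩ := h t ht
    have hX' : ι.preimage (r ≫ t) ≫ ψ.s ≫ φ.f = ι.preimage (r ≫ t) ≫ ψ.f :=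
      ι.map_injective (by simpa using r ≫= hZ)
    have : IsIso (L₁.map (ι.preimage (r ≫ t))) :=
      Localization.inverts L₁ W₁ _ ((hW _).2 (by simpa using hr))
    have : IsIso (L₁.map (ψ.s ≫ φ.s)) :=
      Localization.inverts L₁ W₁ _ (W₁.comp_mem _ _ ψ.hs φ.hs)
    have hL := congr_arg L₁.map hX'
    rw [L₁.map_comp _ (ψ.s ≫ φ.f), L₁.map_comp _ ψ.f, cancel_epi, ← ha, ← hb, cancel_epi,
      cancel_epi, cancel_mono] at hL
    exact hL

end FullyFaithful

/-! ### The section functor -/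

section RightAdjoint

variable [HasEpiLifting M]

variable {D : Type*} [Category* D] (L : ModCat M ⥤ D) [L.IsLocalization (Eff M).isoModSerre]

/-- The section functor of the quotient of `Mod M` by `Eff(M)`: the quotient is identified with
the category of additive sheaves, which is a full subcategory of `Mod M`. -/
def sectionFunctor : D ⥤ ModCat M :=
  (Localization.uniq L (sheafifyMod M) (Eff M).isoModSerre).functor ⋙ (isSheafMod M).ι

instance : (sectionFunctor L).Full := by unfold sectionFunctor; infer_instance

instance : (sectionFunctor L).Faithful := by unfold sectionFunctor; infer_instance

/-- The section functor is right adjoint to the quotient functor. -/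
def sectionAdjunction : L ⊣ sectionFunctor L :=
  ((sheafifyModAdjunction M).comp
    (Localization.uniq L (sheafifyMod M) (Eff M).isoModSerre).symm.toAdjunction).ofNatIsoLeft
      (Localization.compUniqInverse L (sheafifyMod M) (Eff M).isoModSerre)

/-- Because the additive sheaves are closed under filtered colimits in `Mod M`. -/
instance [HasWeakKernels M] : Functor.IsFinitelyAccessible.{u} (sectionFunctor L) := by
  rw [Functor.IsFinitelyAccessible_iff_preservesFilteredColimitsOfSize]
  refine ⟨fun J _ _ ↦ ?_⟩
  unfold sectionFunctor
  infer_instance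

end RightAdjoint

/-! ### Refinement of denominators -/

section Refinement

variable [HasEpiLifting M] [HasWeakKernels M] [HasBinaryBiproducts M]

/-- A morphism `s : G ⟶ F` that is invertible modulo `Eff(M)`, with `F` finitely presented, can be
refined to one whose source is finitely presented. The generator of `F` lifts to `G` after
restriction along an epimorphism `e`; its annihilator is generated by some `k`, and `k` kills the
lift after composition with a further epimorphism `e'`. The source is the cokernel of
`Hom(-, e' ≫ k)`. -/
lemma exists_finitelyPresented_refinement {F G : ModCat M} (hF : finitelyPresented M F)
    (s : G ⟶ F) (hs : (Eff M).isoModSerre s) :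
    ∃ (F' : ModCat M) (t : F' ⟶ G), finitelyPresented M F' ∧ (Eff M).isoModSerre (t ≫ s) := by
  rw [finitelyPresented_iff] at hF
  obtain ⟨⟨B, ξ, hξ⟩, hF⟩ := hF
  obtain ⟨hs₁, hs₂⟩ := hs
  rw [monoModSerre_Eff_iff] at hs₁
  rw [epiModSerre_Eff_iff] at hs₂
  obtain ⟨B', e, g, _, hg⟩ := hs₂ B ξ
  obtain ⟨D, k, hk⟩ := hF B' (res F e ξ)
  obtain ⟨D', e', _, he'⟩ := hs₁ D (res G k g) (by
    rw [evalHom_res, hg]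
    exact (hk k).2 ⟨𝟙 _, by simp⟩)
  let m := (yonedaMod M).map (e' ≫ k)
  have hm : m ≫ ofSec g = 0 := by
    refine hom_ext fun Z t ↦ ?_
    obtain ⟨t, rfl⟩ := homSec_surjective t
    rw [evalHom_comp, evalHom_yonedaMod, evalHom_ofSec, ← Category.assoc, res_comp, res_comp, he',
      map_zero]
    rfl
  let t : cokernel m ⟶ G := cokernel.desc m (ofSec g) hm
  refine ⟨cokernel m, t, ⟨_, _, e' ≫ k, cokernel.π m, cokernel.condition m,
    ⟨cokernelIsCokernel m⟩⟩, ?_, ?_⟩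
  · rw [monoModSerre_Eff_iff]
    intro X x hx
    obtain ⟨x, rfl⟩ := (epi_iff (cokernel.π m)).1 inferInstance X x
    obtain ⟨x, rfl⟩ := homSec_surjective x
    rw [← evalHom_comp, cokernel.π_desc_assoc, evalHom_comp, evalHom_ofSec, evalHom_res, hg] at hx
    obtain ⟨u, rfl⟩ := (hk x).1 hx
    obtain ⟨Y, f, v, _, w⟩ := HasEpiLifting.exists_lift e' u ‹_›
    refine ⟨Y, f, ‹_›, ?_⟩
    rw [← evalHom_res, res_homSec, reassoc_of% w, ← evalHom_yonedaMod, ← evalHom_comp,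
      cokernel.condition, evalHom_zero]
  · rw [epiModSerre_Eff_iff]
    intro X x
    obtain ⟨x, rfl⟩ := hξ x
    obtain ⟨Y, f, y, _, w⟩ := HasEpiLifting.exists_lift e x ‹_›
    refine ⟨Y, f, evalHom (cokernel.π m) Y (homSec y), ‹_›, ?_⟩
    rw [← evalHom_comp, cokernel.π_desc_assoc, evalHom_comp, evalHom_ofSec, evalHom_res, hg,
      ← res_comp, ← res_comp, w]

end Refinement

/-! ### Finitely generated objects and retracts in abelian categories -/

section FinitelyGenerated

variable {C : Type*} [Category* C] [Abelian C]

open ZeroObject in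
/-- The cokernels of `D j ⟶ colim D` form a filtered system with zero colimit, so that a finitely
generated `colim D` is a quotient of some `D j`. -/
lemma IsFinitelyGenerated.exists_epi {J : Type w} [SmallCategory J] [IsFiltered J] {X : C}
    (hX : IsFinitelyGenerated.{w} X) (p : ColimitPresentation J X) : ∃ j, Epi (p.ι.app j) := by
  have hp {j k : J} (a : j ⟶ k) : p.diag.map a ≫ p.ι.app k = p.ι.app j := p.cocone.w a
  let K : J ⥤ C :=
    { obj j := cokernel (p.ι.app j)
      map {j k} a := cokernel.desc _ (cokernel.π (p.ι.app k)) (by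
        rw [← hp a, Category.assoc, cokernel.condition, comp_zero]) }
  have hK {j k : J} (a : j ⟶ k) : cokernel.π (p.ι.app j) ≫ K.map a = cokernel.π (p.ι.app k) :=
    cokernel.π_desc _ _ _
  have hK' {j k : J} (a : j ⟶ k) {Z : C} (g : K.obj k ⟶ Z) :
      cokernel.π (p.ι.app j) ≫ K.map a ≫ g = cokernel.π (p.ι.app k) ≫ g :=
    (Category.assoc _ _ _).symm.trans (congr_arg (· ≫ g) (hK a))
  have zero (s : Cocone K) (j : J) : s.ι.app j = 0 := by
    have h (k : J) : cokernel.π (p.ι.app j) ≫ s.ι.app j = cokernel.π (p.ι.app k) ≫ s.ι.app k := by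
      rw [← s.w (IsFiltered.leftToMax j k), ← s.w (IsFiltered.rightToMax j k)]
      exact (hK' (IsFiltered.leftToMax j k) (s.ι.app _)).trans
        (hK' (IsFiltered.rightToMax j k) (s.ι.app _)).symm
    refine (cancel_epi (cokernel.π (p.ι.app j))).1 (p.isColimit.hom_ext fun k ↦ ?_)
    change p.ι.app k ≫ _ = p.ι.app k ≫ _
    rw [h k, cokernel.condition_assoc, comp_zero, zero_comp, comp_zero]
  let c : Cocone K := { pt := 0, ι := 0 }
  let hc : IsColimit c :=
    { desc s := 0
      fac s j := comp_zero.trans (zero s j).symm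
      uniq s m _ := (isZero_zero C).eq_of_src m 0 }
  obtain ⟨j⟩ : Nonempty J := IsFiltered.nonempty
  obtain ⟨k, a, b, h⟩ := hX J K c hc j j (cokernel.π (p.ι.app j)) 0 (by simp [c])
  exact ⟨k, Preadditive.epi_of_cokernel_zero (by rw [← hK a, h, zero_comp])⟩

/-- A retract of `Y` is the cokernel of an endomorphism of `Y`. -/
lemma isClosedUnderRetracts_of_isClosedUnderCokernels (P : ObjectProperty C)
    [P.IsClosedUnderCokernels] : P.IsStableUnderRetracts where
  of_retract {X Y} h hY := by
    have w : (𝟙 Y - h.r ≫ h.i) ≫ h.r = 0 := by simp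
    exact ObjectProperty.IsClosedUnderCokernels.cokernels_le (P := P) _
      ⟨𝟙 Y - h.r ≫ h.i, CokernelCofork.ofπ h.r w,
      CokernelCofork.IsColimit.ofπ _ _ (fun g _ ↦ h.i ≫ g)
        (fun g hg ↦ by
          rw [Preadditive.sub_comp, Category.id_comp, sub_eq_zero] at hg
          simpa using hg.symm)
        (fun g _ m hm ↦ by simp [← hm]), hY, hY⟩

/-- The image of `X` in `Z` is the kernel of the cokernel of `X ⟶ Z`. -/
lemma prop_of_epi_of_mono (P : ObjectProperty C) [P.IsClosedUnderKernels]
    [P.IsClosedUnderCokernels] [P.IsClosedUnderIsomorphisms] {X Y Z : C} (p : X ⟶ Y) [Epi p]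
    (i : Y ⟶ Z) [Mono i] (hX : P X) (hZ : P Z) : P Y := by
  have : P (cokernel i) := P.prop_of_iso (cokernelEpiComp p i) (P.prop_cokernel _ hX hZ)
  exact P.prop_of_iso ((limit.isLimit _).conePointUniqueUpToIso
    (Abelian.monoIsKernelOfCokernel _ (cokernelIsCokernel i))) (P.prop_kernel _ hZ this)

end FinitelyGenerated

/-! ### Finitely presented objects of the quotient -/

section Quotient

variable [HasEpiLifting M] [HasWeakKernels M] [HasBinaryBiproducts M]

variable {D : Type*} [Category* D] (L : ModCat M ⥤ D) [L.IsLocalization (Eff M).isoModSerre]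

lemma exists_fraction_finitelyPresented {G H : ModCat M} (hG : finitelyPresented M G)
    (hH : finitelyPresented M H) (a : L.obj G ⟶ L.obj H) :
    ∃ (G' : ModCat M) (s : G' ⟶ G) (f : G' ⟶ H), finitelyPresented M G' ∧ IsIso (L.map s) ∧
      L.map s ≫ a = L.map f := by
  obtain ⟨G', s, f, hs, h⟩ := exists_fraction_of_refinement (ι := (finitelyPresented M).ι)
    (W₂ := (Eff M).isoModSerre) L
    (fun X Z s hs ↦ by
      obtain ⟨X', t, hX', ht⟩ := exists_finitelyPresented_refinement X.property s hs
      exact ⟨⟨X', hX'⟩, t, ht⟩) (X := ⟨G, hG⟩) (Y := ⟨H, hH⟩) a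
  exact ⟨G'.obj, s.hom, f.hom, G'.property, Localization.inverts L _ _ hs, h⟩

/-- Every object of the quotient is a filtered colimit of images of finitely presented functors,
and these images are finitely presented: both hold in `Mod M` and pass to the quotient since the
section functor is fully faithful and preserves filtered colimits. -/
lemma isCardinalFilteredGenerator_map [HasZeroObject M] :
    ((finitelyPresented M).map L).IsCardinalFilteredGenerator (ℵ₀ : Cardinal.{u}) := by
  refine (sectionAdjunction L).isCardinalFilteredGenerator ?_
  obtain ⟨P, _, hP⟩ := HasCardinalFilteredGenerator.exists_generator (ModCat M) (ℵ₀ : Cardinal.{u})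
  rw [← isFinitelyPresentable_eq_finitelyPresented]
  exact hP.of_le_isoClosure (hP.le_isCardinalPresentable.trans (ObjectProperty.le_isoClosure _))
    le_rfl

variable [Abelian D] [L.Additive]

/-- Up to isomorphism, a morphism between such images is itself the image of a morphism of finitely
presented functors. -/
instance : ((finitelyPresented M).map L).IsClosedUnderCokernels where
  cokernels_le := by
    rintro _ ⟨f, c, hc, ⟨G, hG, ⟨eG⟩⟩, ⟨H, hH, ⟨eH⟩⟩⟩
    obtain ⟨G', s, g, hG', _, h⟩ := exists_fraction_finitelyPresented L hG hH (eG.hom ≫ f ≫ eH.inv)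
    have := ObjectProperty.SerreClassLocalization.preservesFiniteColimits L (Eff M)
    refine ⟨cokernel g, (finitelyPresented M).prop_cokernel _ hG' hH, ⟨?_⟩⟩
    refine PreservesCokernel.iso L g ≪≫ cokernel.mapIso (L.map g) f (asIso (L.map s) ≪≫ eG) eH ?_
      ≪≫ (cokernelIsCokernel f).coconePointUniqueUpToIso hc
    simp [← h]

instance : ((finitelyPresented M).map L).IsClosedUnderKernels where
  kernels_le := by
    rintro _ ⟨f, c, hc, ⟨G, hG, ⟨eG⟩⟩, ⟨H, hH, ⟨eH⟩⟩⟩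
    obtain ⟨G', s, g, hG', _, h⟩ := exists_fraction_finitelyPresented L hG hH (eG.hom ≫ f ≫ eH.inv)
    have := ObjectProperty.SerreClassLocalization.preservesFiniteLimits L (Eff M)
    refine ⟨kernel g, (finitelyPresented M).prop_kernel _ hG' hH, ⟨?_⟩⟩
    refine PreservesKernel.iso L g ≪≫ kernel.mapIso (L.map g) f (asIso (L.map s) ≪≫ eG) eH ?_
      ≪≫ (kernelIsKernel f).conePointUniqueUpToIso hc
    simp [← h]

variable [HasZeroObject M]

/-- A finitely presented object of the quotient is a retract of the image of a finitely presented
functor, and those images are closed under cokernels, hence under retracts. -/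
lemma isFinitelyPresentable_quotient_eq :
    ObjectProperty.isFinitelyPresentable.{u} D = (finitelyPresented M).map L := by
  have := isClosedUnderRetracts_of_isClosedUnderCokernels ((finitelyPresented M).map L)
  rw [ObjectProperty.isFinitelyPresentable_eq_isCardinalPresentable,
    (isCardinalFilteredGenerator_map L).isPresentable_eq_retractClosure,
    ObjectProperty.retractClosure_eq_self]

end Quotient

lemma isLocallyCoherent_quotient [HasEpiLifting M] [HasWeakKernels M] [HasBinaryBiproducts M]
    [HasZeroObject M] {D : Type*} [Category* D] [Abelian D] (L : ModCat M ⥤ D) [L.Additive]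
    [L.IsLocalization (Eff M).isoModSerre] : IsLocallyCoherent.{u} D := by
  have hgen := isCardinalFilteredGenerator_map L
  have hfp := isFinitelyPresentable_quotient_eq L
  have := (sectionAdjunction L).isCardinalLocallyPresentable (ℵ₀ : Cardinal.{u})
  refine ⟨⟨inferInstance⟩, ⟨inferInstance, ⟨fun _ _ _ ↦ inferInstance⟩, ?_, fun X ↦ ?_⟩, ?_⟩
  · exact inferInstanceAs (ObjectProperty.EssentiallySmall.{u} (isCardinalPresentable D ℵ₀))
  · obtain ⟨J, _, _, ⟨p⟩⟩ := hgen.exists_colimitsOfShape X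
    have := isFiltered_of_isCardinalFiltered J ℵ₀
    rw [hfp]
    exact ⟨J, inferInstance, inferInstance, p.toColimitPresentation, p.prop_diag_obj⟩
  · intro X Y i _ hY hX
    obtain ⟨J, _, _, ⟨p⟩⟩ := hgen.exists_colimitsOfShape X
    have := isFiltered_of_isCardinalFiltered J ℵ₀
    -- a finitely generated object is a quotient of a stage of its presentation, hence an image
    obtain ⟨j, _⟩ := hX.exists_epi p.toColimitPresentation
    change ObjectProperty.isFinitelyPresentable.{u} D Y at hY
    change ObjectProperty.isFinitelyPresentable.{u} D X
    rw [hfp] at hY ⊢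
    exact prop_of_epi_of_mono _ (p.ι.app j) i (p.prop_diag_obj j) hY

end

end DAbelian

open DAbelian in
theorem proposition3p2 (d : ℕ) (hd : 0 < d) (M : Type u) [SmallCategory M] [Preadditive M]
    (hM : DAbelian.IsDAbelian d M) :
    DAbelian.IsLocallyCoherent.{u} (DAbelian.SerreQuotient (DAbelian.Eff M)) ∧
    ∃ Φ : DAbelian.SerreQuotient (DAbelian.eff M) ⥤ DAbelian.SerreQuotient (DAbelian.Eff M),
      Nonempty (DAbelian.quotFunctor (DAbelian.eff M) ⋙ Φ ≅
        (DAbelian.finitelyPresented M).ι ⋙ DAbelian.quotFunctor (DAbelian.Eff M)) ∧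
      Φ.Full ∧ Φ.Faithful ∧
      Φ.essImage =
        ObjectProperty.isFinitelyPresentable.{u} (DAbelian.SerreQuotient (DAbelian.Eff M)) := by
  have := hM.hasFiniteBiproducts
  have : HasBinaryBiproducts M := .of_hasBinaryProducts
  have : HasZeroObject M := inferInstance
  have := hM.hasWeakKernels hd
  have := hM.hasEpiLifting hd
  have hEff := isoModulo_eq_isoModSerre (Eff M)
  have heff := isoModulo_eq_isoModSerre (eff M)
  have : (quotFunctor (Eff M)).IsLocalization (Eff M).isoModSerre := by
    rw [← hEff]; infer_instance
  have : (isoModulo (Eff M)).HasLeftCalculusOfFractions := by rw [hEff]; infer_instance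
  have : (isoModulo (Eff M)).HasRightCalculusOfFractions := by rw [hEff]; infer_instance
  have : (isoModulo (eff M)).HasRightCalculusOfFractions := by rw [heff]; infer_instance
  let _ : Preadditive (SerreQuotient (Eff M)) := inferInstance
  have : (quotFunctor (Eff M)).Additive := inferInstance
  let _ := ObjectProperty.SerreClassLocalization.abelian (quotFunctor (Eff M)) (Eff M)
  refine ⟨isLocallyCoherent_quotient (quotFunctor (Eff M)), ?_⟩
  have hW {F G : FpModCat M} (f : F ⟶ G) :
      isoModulo (eff M) f ↔ isoModulo (Eff M) ((finitelyPresented M).ι.map f) := by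
    rw [hEff, heff]
    exact isoModSerre_eff_iff f
  have hinv : (isoModulo (eff M)).IsInvertedBy
      ((finitelyPresented M).ι ⋙ quotFunctor (Eff M)) := fun _ _ f hf ↦
    Localization.inverts (quotFunctor (Eff M)) (isoModulo (Eff M)) _ ((hW f).1 hf)
  let Φ := Localization.lift _ hinv (quotFunctor (eff M))
  let e : quotFunctor (eff M) ⋙ Φ ≅ (finitelyPresented M).ι ⋙ quotFunctor (Eff M) :=
    Localization.fac _ hinv _
  obtain ⟨h₁, h₂⟩ := full_faithful_of_refinement (quotFunctor (eff M)) (quotFunctor (Eff M))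
    (isoModulo (eff M)) (W₂ := isoModulo (Eff M)) (fun _ _ f ↦ hW f) (fun X Z s hs ↦ by
      rw [hEff] at hs
      obtain ⟨X', t, hX', ht⟩ := exists_finitelyPresented_refinement X.property s hs
      exact ⟨⟨X', hX'⟩, t, by rwa [hEff]⟩) Φ e
  refine ⟨Φ, ⟨e⟩, h₁, h₂, ?_⟩
  rw [isFinitelyPresentable_quotient_eq (quotFunctor (Eff M))]
  ext X
  constructor
  · rintro ⟨A, ⟨i⟩⟩
    have := Localization.essSurj (quotFunctor (eff M)) (isoModulo (eff M))
    let B := (quotFunctor (eff M)).objPreimage A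
    exact ⟨B.obj, B.property, ⟨(e.app B).symm ≪≫
      Φ.mapIso ((quotFunctor (eff M)).objObjPreimageIso A) ≪≫ i⟩⟩
  · rintro ⟨F, hF, ⟨i⟩⟩
    exact ⟨(quotFunctor (eff M)).obj ⟨F, hF⟩, ⟨e.app ⟨F, hF⟩ ≪≫ i⟩⟩
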